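/- A $d$-cube is a polytope (the convex hull of finitely many points of some $\mathbb{R}^n$) whose face lattice is isomorphic to the face lattice of $[0,1]^d$. The graph of a polytope consists of its vertices and edges. A $d$-polytope is *strongly $\lfloor (d+1)/2\rfloor$-linked* if its graph has at least $d+1$ vertices and, for every set $X$ of exactly $d+1$ vertices and every collection of $k=\lfloor (d+1)/2\rfloor$ pairwise disjoint pairs $\{s_1,t_1\},\dots,\{s_k,t_k\}$ of distinct vertices of $X$, there are pairwise vertex-disjoint paths $L_1,\dots,L_k$ in the graph such that $L_i$ joins $s_i$ to $t_i$ and no $L_i$ contains a vertex of $X$ outside $\{s_1,t_1,\dots,s_k,t_k\}$. **Theorem (strong linkedness of the cube).** For every integer $d\ge 0$ with $d\ne 3$, every $d$-cube is strongly $\lfloor (d+1)/2\rfloor$-linked. -/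

import Mathlib

/-- A (convex) polytope in `ℝⁿ`: the convex hull of a finite set of points. -/
def IsPolytope {n : ℕ} (P : Set (EuclideanSpace ℝ (Fin n))) : Prop :=
  ∃ S : Set (EuclideanSpace ℝ (Fin n)), S.Finite ∧ P = convexHull ℝ S

/-- The face lattice of `P`, ordered by inclusion. A face is the empty set or the set of points
of `P` at which some linear functional attains its maximum over `P`; so `∅` and `P` itself are
faces. -/
abbrev FaceLattice {n : ℕ} (P : Set (EuclideanSpace ℝ (Fin n))) : Type :=
  {F : Set (EuclideanSpace ℝ (Fin n)) // IsExposed ℝ P F}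

/-- The standard cube `[0,1]^d` in `ℝ^d`. -/
def stdCube (d : ℕ) : Set (EuclideanSpace ℝ (Fin d)) :=
  {x | ∀ i, 0 ≤ x i ∧ x i ≤ 1}

/-- A `d`-cube: a polytope, in a space of any dimension, that is combinatorially equivalent to
`[0,1]^d`, i.e. the two face lattices are isomorphic. -/
def IsCube {n : ℕ} (d : ℕ) (P : Set (EuclideanSpace ℝ (Fin n))) : Prop :=
  IsPolytope P ∧ Nonempty (FaceLattice P ≃o FaceLattice (stdCube d))

/-- The graph of a polytope: its vertices are the points `v` such that `{v}` is a face, and two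
distinct vertices are adjacent when the segment joining them is a face. -/
def polytopeGraph {n : ℕ} (P : Set (EuclideanSpace ℝ (Fin n))) :
    SimpleGraph {v : EuclideanSpace ℝ (Fin n) // IsExposed ℝ P {v}} where
  Adj u v := u ≠ v ∧ IsExposed ℝ P (segment ℝ u.1 v.1)
  symm := ⟨fun u v h => ⟨h.1.symm, by rw [segment_symm]; exact h.2⟩⟩
  loopless := ⟨fun _ h => h.1 rfl⟩

/-- A graph is strongly `⌊(d+1)/2⌋`-linked (with respect to `d`) if it has at least `d + 1`
vertices and, for every set `X` of exactly `d + 1` vertices and every choice of `⌊(d+1)/2⌋`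
pairwise disjoint pairs `{s i, t i}` of distinct vertices of `X`, there are pairwise
vertex-disjoint paths `L i` from `s i` to `t i`, each avoiding the vertices of `X` that are in
none of the pairs. -/
def IsStronglyLinked {V : Type*} (d : ℕ) (G : SimpleGraph V) : Prop :=
  ((d + 1 : ℕ) : ℕ∞) ≤ ENat.card V ∧
  ∀ X : Finset V, X.card = d + 1 →
    ∀ s t : Fin ((d + 1) / 2) → V,
      (∀ i, s i ∈ X) → (∀ i, t i ∈ X) → Function.Injective (Sum.elim s t) →
      ∃ L : ∀ i, G.Path (s i) (t i),
        (∀ i j, i ≠ j → ∀ v, v ∈ (L i).1.support → v ∉ (L j).1.support) ∧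
        ∀ x ∈ X, (∀ j, x ≠ s j ∧ x ≠ t j) → ∀ i, x ∉ (L i).1.support

/-!
Disjoint paths are encoded by colouring the vertices of the `d`-cube so that terminals of equal
label are joined inside their colour class; this turns linkage into a statement about labellings of
at most `d + 1` vertices in which no label occurs more than twice, proved by induction on `d`.

A direction `i` splits the cube into two facets. If the pairs with one end in each facet can change
sides along distinct edges in direction `i`, without meeting other terminals and without giving a
facet more than `d` terminals, the induction hypothesis in the two facets concludes. When all
terminals lie in one facet, that facet links all but one of them; only the connection through the
omitted terminal is interrupted, and its two loose ends, like the omitted terminal and its partner,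
are joined through the opposite facet. The directions left are obstructed by edges between
terminals. If every direction were obstructed, the terminals would span edges in all `d` directions,
and `d + 1` vertices that do so have a facet containing exactly one of them; in the direction of
that facet the pairs can change sides after all.

The induction starts at `d = 4`, where the only stubborn configurations involve two pairs of
vertices; for `d ≤ 2` there is at most one pair to join, and for `d = 3` two crossing pairs on a
quadrilateral face cannot be linked. Finally, the vertices of a polytope are the atoms of its face
lattice and its edges are the faces that contain exactly two vertices, so a combinatorial
equivalence carries the graph of `[0,1]^d` to that of every `d`-cube.
-/

section Linkage

variable {V W ι : Type*} {G : SimpleGraph V} {H : SimpleGraph W}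

/-- The subgraph of `G` formed by the edges inside `A` whose two ends have the same colour. A family
of disjoint paths is encoded as a colouring `c`: each path runs inside one colour class, so that
disjointness is automatic. -/
def monochromaticOn (G : SimpleGraph V) (c : V → ι) (A : Set V) : SimpleGraph V where
  Adj u v := G.Adj u v ∧ c u = c v ∧ u ∈ A ∧ v ∈ A
  symm := ⟨fun _ _ h => ⟨h.1.symm, h.2.1.symm, h.2.2.2, h.2.2.1⟩⟩
  loopless := ⟨fun _ h => h.1.ne rfl⟩

theorem monochromaticOn_le {c c' : V → ι} {A B : Set V} (hAB : A ⊆ B) (hc : Set.EqOn c c' A) :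
    monochromaticOn G c A ≤ monochromaticOn G c' B := fun _ _ h =>
  ⟨h.1, by rw [← hc h.2.2.1, ← hc h.2.2.2, h.2.1], hAB h.2.2.1, hAB h.2.2.2⟩

theorem monochromaticOn_le_graph (c : V → ι) (A : Set V) : monochromaticOn G c A ≤ G :=
  fun _ _ h => h.1

theorem color_eq_of_reachable {c : V → ι} {A : Set V} {u v : V}
    (h : (monochromaticOn G c A).Reachable u v) : c u = c v := by
  obtain ⟨w⟩ := h
  induction w with
  | nil => rfl
  | cons h _ ih => exact h.2.1.trans ih

theorem reachable_of_induce_preconnected {c : V → ι} {A : Set V} (hA : (G.induce A).Preconnected)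
    {k : ι} (hc : ∀ v ∈ A, c v = k) {u v : V} (hu : u ∈ A) (hv : v ∈ A) :
    (monochromaticOn G c Set.univ).Reachable u v :=
  (hA ⟨u, hu⟩ ⟨v, hv⟩).map (G' := monochromaticOn G c Set.univ)
    ⟨Subtype.val, fun {a b} h => ⟨h, by rw [hc a a.2, hc b b.2], trivial, trivial⟩⟩

/-- Every label is used at most twice on `Y`. -/
def PairLabelled (Y : Finset V) (l : V → ι) : Prop :=
  ∀ x ∈ Y, ∀ y ∈ Y, ∀ z ∈ Y, l x = l y → l x = l z → x = y ∨ x = z ∨ y = z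

theorem PairLabelled.subset {X Y : Finset V} {l : V → ι} (h : PairLabelled Y l) (hX : X ⊆ Y) :
    PairLabelled X l :=
  fun x hx y hy z hz => h x (hX hx) y (hX hy) z (hX hz)

theorem PairLabelled.card_filter_le_two [DecidableEq ι] {Y : Finset V} {l : V → ι}
    (h : PairLabelled Y l) (k : ι) : {y ∈ Y | l y = k}.card ≤ 2 := by
  by_contra! hlt
  obtain ⟨x, y, z, hx, hy, hz, hxy, hxz, hyz⟩ := Finset.two_lt_card_iff.1 hlt
  rw [Finset.mem_filter] at hx hy hz
  have := h x hx.1 y hy.1 z hz.1 (hx.2.trans hy.2.symm) (hx.2.trans hz.2.symm)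
  tauto

theorem PairLabelled.of_card_le_two {Y : Finset V} (hY : Y.card ≤ 2) (l : V → ι) :
    PairLabelled Y l := fun x hx y hy z hz _ _ => by
  by_contra! hne
  exact hY.not_gt (Finset.two_lt_card_iff.2 ⟨x, y, z, hx, hy, hz, hne⟩)

theorem PairLabelled.union [DecidableEq V] {S T : Finset V} {l : V → ι} (hS : PairLabelled S l)
    (hT : PairLabelled T l) (hST : ∀ s ∈ S, ∀ t ∈ T, l s ≠ l t) : PairLabelled (S ∪ T) l := by
  intro x hx y hy z hz hxy hxz
  rcases Finset.mem_union.1 hx with hx | hx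
  · exact hS x hx y ((Finset.mem_union.1 hy).resolve_right fun h => hST x hx y h hxy)
      z ((Finset.mem_union.1 hz).resolve_right fun h => hST x hx z h hxz) hxy hxz
  · exact hT x hx y ((Finset.mem_union.1 hy).resolve_left fun h => hST y h x hx hxy.symm)
      z ((Finset.mem_union.1 hz).resolve_left fun h => hST z h x hx hxz.symm) hxy hxz

theorem PairLabelled.of_map {f : V ↪ W} {Y : Finset V} {l : W → ι} (h : PairLabelled (Y.map f) l) :
    PairLabelled Y (l ∘ f) := fun x hx y hy z hz hxy hxz => by
  simpa only [f.injective.eq_iff] using h (f x) (Finset.mem_map_of_mem f hx) (f y)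
    (Finset.mem_map_of_mem f hy) (f z) (Finset.mem_map_of_mem f hz) hxy hxz

/-- The labelling `l` of the terminals `Y` extends to a colouring in which terminals with the same
label are joined inside `A` by monochromatic walks. -/
def Linkable (G : SimpleGraph V) (A : Set V) (Y : Finset V) (l : V → ι) : Prop :=
  ∃ c : V → ι, (∀ y ∈ Y, c y = l y) ∧
    ∀ x ∈ Y, ∀ y ∈ Y, l x = l y → (monochromaticOn G c A).Reachable x y

theorem Linkable.map {Y : Finset V} {l : W → ι} (f : G ↪g H)
    (h : Linkable G Set.univ Y (l ∘ f)) :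
    Linkable H (Set.range f) (Y.map f.toEmbedding) l := by
  obtain ⟨c, hc, hreach⟩ := h
  have hext : ∀ v, Function.extend f c l (f v) = c v := f.injective.extend_apply c l
  let F : monochromaticOn G c Set.univ →g
      monochromaticOn H (Function.extend f c l) (Set.range f) :=
    ⟨f, fun h => ⟨f.map_adj_iff.2 h.1, by rw [hext, hext, h.2.1], ⟨_, rfl⟩, ⟨_, rfl⟩⟩⟩
  refine ⟨Function.extend f c l, ?_, ?_⟩
  · simp only [Finset.forall_mem_map]
    exact fun y hy => (hext y).trans (hc y hy)
  · simp only [Finset.forall_mem_map]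
    exact fun x hx y hy hxy => (hreach x hx y hy hxy).map F

/-- The involution `σ` of `X` exchanges the two points of each label class of size two and fixes
the points whose label is used only once. -/
structure IsPartner (X : Finset V) (l : V → ι) (σ : V → V) : Prop where
  mem : ∀ x ∈ X, σ x ∈ X
  label : ∀ x ∈ X, l (σ x) = l x
  invol : ∀ x ∈ X, σ (σ x) = x
  eq_or : ∀ x ∈ X, ∀ y ∈ X, l x = l y → y = x ∨ y = σ x

theorem PairLabelled.exists_partner {X : Finset V} {l : V → ι} (h : PairLabelled X l) {x : V}
    (hx : x ∈ X) : ∃ y ∈ X, l y = l x ∧ ∀ z ∈ X, l x = l z → z = x ∨ z = y := by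
  by_cases hy : ∃ y ∈ X, y ≠ x ∧ l y = l x
  · obtain ⟨y, hy, hne, hl⟩ := hy
    refine ⟨y, hy, hl, fun z hz hlz => ?_⟩
    rcases h x hx y hy z hz hl.symm hlz with h | h | h
    exacts [absurd h.symm hne, Or.inl h.symm, Or.inr h.symm]
  · push Not at hy
    exact ⟨x, hx, rfl, fun z hz hlz => Or.inl (by_contra fun hzx => hy z hz hzx hlz.symm)⟩

theorem PairLabelled.exists_isPartner {X : Finset V} {l : V → ι} (h : PairLabelled X l) :
    ∃ σ, IsPartner X l σ := by
  have : ∀ x, ∃ y, x ∈ X → y ∈ X ∧ l y = l x ∧ ∀ z ∈ X, l x = l z → z = x ∨ z = y := fun x => by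
    by_cases hx : x ∈ X
    · obtain ⟨y, hy⟩ := h.exists_partner hx
      exact ⟨y, fun _ => hy⟩
    · exact ⟨x, fun h => absurd h hx⟩
  choose σ hσ using this
  refine ⟨σ, fun x hx => (hσ x hx).1, fun x hx => (hσ x hx).2.1, fun x hx => ?_,
    fun x hx => (hσ x hx).2.2⟩
  obtain ⟨hmem, hlabel, heq⟩ := hσ x hx
  obtain ⟨hmem', hlabel', heq'⟩ := hσ (σ x) hmem
  rcases heq (σ (σ x)) hmem' (by rw [hlabel', hlabel]) with h | h
  · exact h
  · rcases heq' x hx hlabel with h' | h'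
    exacts [h.trans h'.symm, h'.symm]

namespace IsPartner

variable {X : Finset V} {l : V → ι} {σ : V → V}

theorem eq_of_label_eq (h : IsPartner X l σ) {x y : V} (hx : x ∈ X) (hy : y ∈ X)
    (hl : l x = l y) (hne : y ≠ x) : y = σ x :=
  (h.eq_or x hx y hy hl).resolve_left hne

theorem pairLabelled (h : IsPartner X l σ) : PairLabelled X l := by
  intro x hx y hy z hz hxy hxz
  by_contra! hne
  exact hne.2.2 ((h.eq_of_label_eq hx hy hxy hne.1.symm).trans
    (h.eq_of_label_eq hx hz hxz hne.2.1.symm).symm)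

end IsPartner

end Linkage

section Flip

variable {α : Type*} [DecidableEq α]

/-- The vertex adjacent to `x` along the edge in direction `i`: the coordinate `x i` is changed. -/
def flipAt (x : α → Bool) (i : α) : α → Bool :=
  Function.update x i (!x i)

@[simp] theorem flipAt_same (x : α → Bool) (i : α) : flipAt x i i = !x i := by
  simp [flipAt]

theorem flipAt_of_ne (x : α → Bool) {i j : α} (h : j ≠ i) : flipAt x i j = x j := by
  simp [flipAt, h]

@[simp] theorem flipAt_flipAt (x : α → Bool) (i : α) : flipAt (flipAt x i) i = x := by
  simp [flipAt]

theorem flipAt_apply_ne (x : α → Bool) (i : α) : flipAt x i i ≠ x i := by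
  simp

theorem flipAt_ne (x : α → Bool) (i : α) : flipAt x i ≠ x := fun h =>
  flipAt_apply_ne x i (congrFun h i)

theorem flipAt_left_injective (i : α) : Function.Injective fun x : α → Bool => flipAt x i :=
  fun x y h => by simpa using congrArg (fun z => flipAt z i) h

theorem eq_flipAt_of_forall {x y : α → Bool} {i : α} (hi : y i ≠ x i) (h : ∀ j ≠ i, y j = x j) :
    y = flipAt x i := by
  ext j
  by_cases hj : j = i
  · rw [hj, flipAt_same, Bool.eq_not_iff.2 hi]
  · rw [h j hj, flipAt_of_ne x hj]

theorem eq_or_eq_flipAt_iff {x y : α → Bool} {i : α} :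
    y = x ∨ y = flipAt x i ↔ ∀ j ≠ i, y j = x j := by
  constructor
  · rintro (rfl | rfl) j hj
    exacts [rfl, flipAt_of_ne x hj]
  · intro h
    by_cases hi : y i = x i
    · exact Or.inl (funext fun j => (eq_or_ne j i).elim (fun hj => hj ▸ hi) (h j))
    · exact Or.inr (eq_flipAt_of_forall hi h)

end Flip

section CubeGraph

variable {d : ℕ}

/-- The graph of the `d`-dimensional cube, on the vertex set `{0,1}^d`. -/
def cubeGraph (d : ℕ) : SimpleGraph (Fin d → Bool) where
  Adj x y := ∃ i, y = flipAt x i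
  symm := ⟨fun x y ⟨i, h⟩ => ⟨i, by simp [h]⟩⟩
  loopless := ⟨fun x ⟨i, h⟩ => flipAt_ne x i h.symm⟩

theorem cubeGraph_adj_flipAt (x : Fin d → Bool) (i : Fin d) :
    (cubeGraph d).Adj x (flipAt x i) := ⟨i, rfl⟩

theorem flipAt_insertNth (i : Fin (d + 1)) (b : Bool) (y : Fin d → Bool) :
    flipAt (i.insertNth b y : Fin (d + 1) → Bool) i = i.insertNth (!b) y :=
  (eq_flipAt_of_forall (by simp) (Fin.succAboveCases i (fun h => absurd rfl h)
    (fun j _ => by simp))).symm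

theorem flipAt_insertNth_succAbove (i : Fin (d + 1)) (b : Bool) (y : Fin d → Bool) (j : Fin d) :
    flipAt (i.insertNth b y : Fin (d + 1) → Bool) (i.succAbove j) = i.insertNth b (flipAt y j) := by
  refine (eq_flipAt_of_forall (by simp) (Fin.succAboveCases i (fun _ => by simp)
    (fun k hk => ?_))).symm
  have hkj : k ≠ j := fun h => hk (h ▸ rfl)
  simp [flipAt_of_ne y hkj]

theorem insertNth_right_injective (i : Fin (d + 1)) (b : Bool) :
    Function.Injective fun y : Fin d → Bool => (i.insertNth b y : Fin (d + 1) → Bool) :=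
  Fin.insertNth_right_injective (α := fun _ => Bool) b

/-- The inclusion of the facet `x i = b` of the `(d + 1)`-cube, identified with the `d`-cube. -/
def facetEmbedding (i : Fin (d + 1)) (b : Bool) : cubeGraph d ↪g cubeGraph (d + 1) where
  toFun y := i.insertNth b y
  inj' := insertNth_right_injective i b
  map_rel_iff' {x y} := by
    change (∃ j, i.insertNth b y = flipAt (i.insertNth b x : Fin (d + 1) → Bool) j) ↔ _
    constructor
    · rintro ⟨j, hj⟩
      obtain rfl | ⟨j, rfl⟩ := i.eq_self_or_eq_succAbove j
      · exact absurd (congrFun hj j) (by simp)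
      · exact ⟨j, insertNth_right_injective i b
          (hj.trans (flipAt_insertNth_succAbove i b x j))⟩
    · rintro ⟨j, rfl⟩
      exact ⟨i.succAbove j, (flipAt_insertNth_succAbove i b x j).symm⟩

theorem facetEmbedding_apply_same (i : Fin (d + 1)) (b : Bool) (y : Fin d → Bool) :
    facetEmbedding i b y i = b :=
  Fin.insertNth_apply_same (α := fun _ => Bool) i b y

theorem facetEmbedding_removeNth {i : Fin (d + 1)} {b : Bool} {x : Fin (d + 1) → Bool}
    (hx : x i = b) : facetEmbedding i b (i.removeNth x) = x :=
  hx ▸ Fin.insertNth_self_removeNth i x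

theorem removeNth_facetEmbedding (i : Fin (d + 1)) (b : Bool) (y : Fin d → Bool) :
    i.removeNth (facetEmbedding i b y) = y :=
  Fin.removeNth_insertNth (α := fun _ => Bool) i b y

theorem flipAt_facetEmbedding (i : Fin (d + 1)) (b : Bool) (y : Fin d → Bool) :
    flipAt (facetEmbedding i b y) i = facetEmbedding i (!b) y :=
  flipAt_insertNth i b y

theorem eq_or_eq_flipAt_of_removeNth_eq {x y : Fin (d + 1) → Bool} {i : Fin (d + 1)}
    (h : i.removeNth x = i.removeNth y) : y = x ∨ y = flipAt x i := by
  rw [← facetEmbedding_removeNth (x := x) (i := i) rfl,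
    ← facetEmbedding_removeNth (x := y) (i := i) rfl, h, flipAt_facetEmbedding]
  by_cases hi : y i = x i
  · rw [hi]
    exact Or.inl rfl
  · rw [Bool.eq_not_iff.2 hi]
    exact Or.inr rfl

theorem range_facetEmbedding (i : Fin (d + 1)) (b : Bool) :
    Set.range (facetEmbedding i b) = {x | x i = b} := by
  ext x
  constructor
  · rintro ⟨y, rfl⟩
    exact facetEmbedding_apply_same i b y
  · exact fun hx => ⟨_, facetEmbedding_removeNth hx⟩

end CubeGraph

section Connectivity

variable {V W : Type*} {G : SimpleGraph V} {H : SimpleGraph W} {d : ℕ}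

theorem preconnected_induce_image (f : G →g H) {A : Set V} (hA : (G.induce A).Preconnected) :
    (H.induce (f '' A)).Preconnected :=
  hA.map (SimpleGraph.induceHom f (Set.mapsTo_image f A)) (Set.surjective_mapsTo_image_restrict f A)

theorem preconnected_induce_of_forall_adj {A B : Set V} (hA : (G.induce A).Preconnected)
    (hAB : A ⊆ B) (hB : ∀ v ∈ B, v ∉ A → ∃ u ∈ A, G.Adj v u) : (G.induce B).Preconnected := by
  have toA : ∀ v : B, ∃ u : A, (G.induce B).Reachable v ⟨u, hAB u.2⟩ := fun v => by
    by_cases hv : v.1 ∈ A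
    · exact ⟨⟨v, hv⟩, .refl _⟩
    · obtain ⟨u, hu, hadj⟩ := hB v v.2 hv
      exact ⟨⟨u, hu⟩, SimpleGraph.Adj.reachable (G := G.induce B) (u := v) (v := ⟨u, hAB hu⟩) hadj⟩
  intro v w
  obtain ⟨u, hu⟩ := toA v
  obtain ⟨u', hu'⟩ := toA w
  exact (hu.trans ((hA u u').map (G.induceHomOfLE hAB).toHom)).trans hu'.symm

theorem preconnected_induce_facet_diff
    (hd : ∀ Z : Finset (Fin d → Bool), Z.card ≤ d - 1 →
      ((cubeGraph d).induce {x | x ∉ Z}).Preconnected)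
    (i : Fin (d + 1)) (b : Bool) {Z : Finset (Fin (d + 1) → Bool)}
    (hZ : {z ∈ Z | z i = b}.card ≤ d - 1) :
    ((cubeGraph (d + 1)).induce {x | x i = b ∧ x ∉ Z}).Preconnected := by
  suffices h : {x | x i = b ∧ x ∉ Z} =
      facetEmbedding i b '' {y | y ∉ {z ∈ Z | z i = b}.image i.removeNth} by
    rw [h]
    exact preconnected_induce_image (facetEmbedding i b).toHom
      (hd _ (Finset.card_image_le.trans hZ))
  ext x
  simp only [Set.mem_ofPred_eq, Set.mem_image, Finset.mem_image, Finset.mem_filter]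
  constructor
  · rintro ⟨hx, hxZ⟩
    refine ⟨i.removeNth x, ?_, facetEmbedding_removeNth hx⟩
    rintro ⟨z, ⟨hzZ, hz⟩, hzx⟩
    rw [← facetEmbedding_removeNth hx, ← hzx, facetEmbedding_removeNth hz] at hxZ
    exact hxZ hzZ
  · rintro ⟨y, hy, rfl⟩
    have hyi := facetEmbedding_apply_same i b y
    exact ⟨hyi, fun h => hy ⟨_, ⟨h, hyi⟩, removeNth_facetEmbedding i b y⟩⟩

theorem exists_edge_avoiding {Z : Finset (Fin (d + 1) → Bool)} (hZ : Z.card < 2 ^ d)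
    (i : Fin (d + 1)) : ∃ y : Fin d → Bool, ∀ b, facetEmbedding i b y ∉ Z := by
  obtain ⟨y, -, hy⟩ := Finset.exists_mem_notMem_of_card_lt_card
    (s := Z.image i.removeNth) (t := Finset.univ)
    (Finset.card_image_le.trans_lt (hZ.trans_eq (by simp)))
  exact ⟨y, fun b h => hy (Finset.mem_image.2 ⟨_, h, removeNth_facetEmbedding i b y⟩)⟩

theorem cubeGraph_induce_compl_preconnected (d : ℕ) (Z : Finset (Fin d → Bool))
    (hZ : Z.card ≤ d - 1) : ((cubeGraph d).induce {x | x ∉ Z}).Preconnected := by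
  induction d with
  | zero => exact .of_subsingleton
  | succ d ih =>
    by_cases hfree : ∃ b, ∀ z ∈ Z, z 0 ≠ b
    · obtain ⟨b, hb⟩ := hfree
      refine preconnected_induce_of_forall_adj
        (preconnected_induce_facet_diff ih 0 b (Z := Z) ?_) (fun x hx => hx.2) fun x hx hxb => ?_
      · rw [Finset.filter_false_of_mem hb]
        simp
      · have hflip : flipAt x 0 0 = b := by
          rw [flipAt_same, ← Bool.eq_not.2 fun h => hxb ⟨h.symm, hx⟩]
        exact ⟨_, ⟨hflip, fun h => hb _ h hflip⟩, cubeGraph_adj_flipAt x 0⟩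
    · push Not at hfree
      have hcard : ∀ b, {z ∈ Z | z 0 = b}.card ≤ d - 1 := fun b => by
        obtain ⟨z, hz, hzb⟩ := hfree (!b)
        have hlt : {z ∈ Z | z 0 = b}.card < Z.card :=
          Finset.card_lt_card (Finset.filter_ssubset.2 ⟨z, hz, Bool.eq_not_iff.1 hzb⟩)
        omega
      obtain ⟨y, hy⟩ := exists_edge_avoiding (Z := Z) (hZ.trans_lt d.lt_two_pow_self) 0
      have hedge : (cubeGraph (d + 1)).Adj (facetEmbedding 0 false y) (facetEmbedding 0 true y) :=
        ⟨0, (flipAt_facetEmbedding 0 false y).symm⟩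
      have hunion : {x | x ∉ Z} = {x | x 0 = false ∧ x ∉ Z} ∪ {x | x 0 = true ∧ x ∉ Z} := by
        ext x
        cases hx : x 0 <;> simp [hx]
      rw [hunion]
      exact (SimpleGraph.connected_induce_union
        (preconnected_induce_facet_diff ih 0 false (hcard false))
        (preconnected_induce_facet_diff ih 0 true (hcard true))
        ⟨rfl, hy false⟩ ⟨rfl, hy true⟩ hedge).preconnected

theorem facet_diff_preconnected (i : Fin (d + 1)) (b : Bool) {Z : Finset (Fin (d + 1) → Bool)}
    (hZ : {z ∈ Z | z i = b}.card ≤ d - 1) :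
    ((cubeGraph (d + 1)).induce {x | x i = b ∧ x ∉ Z}).Preconnected :=
  preconnected_induce_facet_diff (cubeGraph_induce_compl_preconnected d) i b hZ

end Connectivity

section Facets

variable {d : ℕ}

/-- The `d`-cube links every labelling of at most `d + 1` vertices in which no label is used more
than twice: the form of strong linkedness on which the induction runs. -/
def CubeLinked (d : ℕ) : Prop :=
  ∀ (Y : Finset (Fin d → Bool)) (l : (Fin d → Bool) → ℕ), Y.card ≤ d + 1 → PairLabelled Y l →
    Linkable (cubeGraph d) Set.univ Y l

theorem CubeLinked.linkable_facet (hd : CubeLinked d) (i : Fin (d + 1)) (b : Bool)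
    {Y : Finset (Fin (d + 1) → Bool)} {l : (Fin (d + 1) → Bool) → ℕ} (hY : ∀ y ∈ Y, y i = b)
    (hcard : Y.card ≤ d + 1) (hl : PairLabelled Y l) :
    Linkable (cubeGraph (d + 1)) {x | x i = b} Y l := by
  obtain ⟨Y, rfl⟩ : ∃ Y', Y = Finset.map (facetEmbedding i b).toEmbedding Y' := by
    refine ⟨Y.image i.removeNth, ?_⟩
    rw [Finset.map_eq_image, Finset.image_image]
    exact (Finset.image_id.symm).trans
      (Finset.image_congr fun y hy => (facetEmbedding_removeNth (hY y hy)).symm)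
  rw [Finset.card_map] at hcard
  rw [← range_facetEmbedding]
  exact (hd Y _ hcard hl.of_map).map _

theorem CubeLinked.exists_coloring_of_facets (hd : CubeLinked d) (i : Fin (d + 1))
    {Z : Finset (Fin (d + 1) → Bool)} {l : (Fin (d + 1) → Bool) → ℕ}
    (hcard : ∀ b, {z ∈ Z | z i = b}.card ≤ d + 1)
    (hl : ∀ b, PairLabelled {z ∈ Z | z i = b} l) :
    ∃ c : (Fin (d + 1) → Bool) → ℕ, (∀ z ∈ Z, c z = l z) ∧
      ∀ x ∈ Z, ∀ y ∈ Z, x i = y i → l x = l y →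
        (monochromaticOn (cubeGraph (d + 1)) c Set.univ).Reachable x y := by
  choose c hc hreach using fun b => hd.linkable_facet i b (by simp) (hcard b) (hl b)
  refine ⟨fun x => c (x i) x, fun z hz => hc (z i) z (by simp [hz]), fun x hx y hy hxy hlxy => ?_⟩
  refine (hreach (x i) x (by simp [hx]) y (by simp [hy, hxy]) hlxy).mono
    (monochromaticOn_le (Set.subset_univ _) fun u hu => ?_)
  rw [show u i = x i from hu]

end Facets

section Exits

variable {ι : Type*} {d : ℕ} {X : Finset (Fin (d + 1) → Bool)} {l : (Fin (d + 1) → Bool) → ι}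
  {σ : (Fin (d + 1) → Bool) → (Fin (d + 1) → Bool)} {i : Fin (d + 1)} {e : ι → Fin d → Bool}

/-- The vertices of `X` whose partner lies in the opposite facet in direction `i`. -/
def crossing {d : ℕ} (X : Finset (Fin d → Bool)) (σ : (Fin d → Bool) → (Fin d → Bool))
    (i : Fin d) : Finset (Fin d → Bool) :=
  {s ∈ X | σ s i ≠ s i}

theorem mem_crossing {d : ℕ} {X : Finset (Fin d → Bool)} {σ : (Fin d → Bool) → (Fin d → Bool)}
    {i : Fin d} {s : Fin d → Bool} : s ∈ crossing X σ i ↔ s ∈ X ∧ σ s i ≠ s i :=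
  Finset.mem_filter

theorem IsPartner.partner_mem_crossing {d : ℕ} {X : Finset (Fin d → Bool)}
    {l : (Fin d → Bool) → ι} {σ : (Fin d → Bool) → (Fin d → Bool)} {i : Fin d}
    (hσ : IsPartner X l σ) {s : Fin d → Bool} (hs : s ∈ crossing X σ i) :
    σ s ∈ crossing X σ i := by
  obtain ⟨hs, hsi⟩ := mem_crossing.1 hs
  exact mem_crossing.2 ⟨hσ.mem s hs, by rw [hσ.invol s hs]; exact hsi.symm⟩

theorem IsPartner.eq_of_crossing (hσ : IsPartner X l σ) {s x : Fin (d + 1) → Bool}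
    (hs : s ∈ crossing X σ i) (hx : x ∈ X) (hl : l x = l s) (hi : x i = s i) : x = s := by
  obtain ⟨hs, hsi⟩ := mem_crossing.1 hs
  by_contra hne
  exact hsi (hσ.eq_of_label_eq hs hx hl.symm hne ▸ hi)

/-- The vertex at which the pair with the label of `s` uses, on the side of `s`, the edge in
direction `i` above `e (l s)`. -/
def exitVertex (l : (Fin (d + 1) → Bool) → ι) (i : Fin (d + 1)) (e : ι → Fin d → Bool)
    (s : Fin (d + 1) → Bool) : Fin (d + 1) → Bool :=
  facetEmbedding i (s i) (e (l s))

theorem exitVertex_apply_same (s : Fin (d + 1) → Bool) : exitVertex l i e s i = s i :=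
  facetEmbedding_apply_same i _ _

theorem IsPartner.exitVertex_partner (hσ : IsPartner X l σ) {s : Fin (d + 1) → Bool}
    (hs : s ∈ crossing X σ i) : exitVertex l i e (σ s) = flipAt (exitVertex l i e s) i := by
  obtain ⟨hs, hsi⟩ := mem_crossing.1 hs
  rw [exitVertex, hσ.label s hs, Bool.eq_not_iff.2 hsi]
  exact (flipAt_facetEmbedding i _ _).symm

/-- An assignment of edges in direction `i` to labels, `e k` being the common projection of the
ends of the edge for the label `k`, by which all crossing pairs can change sides: distinct pairs
use distinct edges, and no edge runs into a foreign terminal. -/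
structure IsExit (X : Finset (Fin (d + 1) → Bool)) (l : (Fin (d + 1) → Bool) → ι)
    (σ : (Fin (d + 1) → Bool) → (Fin (d + 1) → Bool)) (i : Fin (d + 1))
    (e : ι → Fin d → Bool) : Prop where
  label_eq : ∀ s ∈ crossing X σ i, ∀ t ∈ crossing X σ i, e (l s) = e (l t) → l s = l t
  eq_self : ∀ s ∈ crossing X σ i, exitVertex l i e s ∈ X → exitVertex l i e s = s

/-- The terminals of `X` together with the new terminals at which crossing pairs change sides. -/
def exitTerminals (X : Finset (Fin (d + 1) → Bool)) (l : (Fin (d + 1) → Bool) → ι)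
    (σ : (Fin (d + 1) → Bool) → (Fin (d + 1) → Bool)) (i : Fin (d + 1))
    (e : ι → Fin d → Bool) : Finset (Fin (d + 1) → Bool) :=
  X ∪ (crossing X σ i).image (exitVertex l i e)

theorem exitVertex_mem_exitTerminals {s : Fin (d + 1) → Bool} (hs : s ∈ crossing X σ i) :
    exitVertex l i e s ∈ exitTerminals X l σ i e :=
  Finset.mem_union_right _ (Finset.mem_image_of_mem _ hs)

theorem IsExit.exists_label (he : IsExit X l σ i e) :
    ∃ m : (Fin (d + 1) → Bool) → ι, (∀ x ∈ X, m x = l x) ∧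
      ∀ s ∈ crossing X σ i, m (exitVertex l i e s) = l s := by
  classical
  set q := exitVertex l i e
  set K := crossing X σ i
  refine ⟨fun z => if z ∈ X then l z else l (Function.invFunOn q K z), fun x hx => by simp [hx],
    fun s hs => ?_⟩
  by_cases hq : q s ∈ X
  · simp only [hq, if_true]
    exact congrArg l (he.eq_self s hs hq)
  · have hex : ∃ t ∈ (K : Set (Fin (d + 1) → Bool)), q t = q s := ⟨s, hs, rfl⟩
    have heq : q (Function.invFunOn q K (q s)) = q s := Function.invFunOn_eq hex
    simp only [hq, if_false]
    refine he.label_eq _ (Function.invFunOn_mem hex) s hs ?_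
    simpa only [q, exitVertex, removeNth_facetEmbedding] using congrArg i.removeNth heq

theorem exists_origin_of_mem_exitTerminals {m : (Fin (d + 1) → Bool) → ι}
    (hmX : ∀ x ∈ X, m x = l x)
    (hm : ∀ s ∈ crossing X σ i, m (exitVertex l i e s) = l s) {z : Fin (d + 1) → Bool}
    (hz : z ∈ exitTerminals X l σ i e) :
    ∃ x ∈ X, x i = z i ∧ l x = m z ∧ (z = x ∨ x ∈ crossing X σ i ∧ z = exitVertex l i e x) := by
  rcases Finset.mem_union.1 hz with hz | hz
  · exact ⟨z, hz, rfl, (hmX z hz).symm, Or.inl rfl⟩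
  · obtain ⟨s, hs, rfl⟩ := Finset.mem_image.1 hz
    exact ⟨s, (mem_crossing.1 hs).1, (exitVertex_apply_same s).symm, (hm s hs).symm,
      Or.inr ⟨hs, rfl⟩⟩

theorem IsPartner.pairLabelled_exitTerminals (hσ : IsPartner X l σ)
    {m : (Fin (d + 1) → Bool) → ι} (hmX : ∀ x ∈ X, m x = l x)
    (hm : ∀ s ∈ crossing X σ i, m (exitVertex l i e s) = l s) (b : Bool) :
    PairLabelled {z ∈ exitTerminals X l σ i e | z i = b} m := by
  intro x hx y hy z hz hxy hxz
  obtain ⟨hxZ, rfl⟩ := Finset.mem_filter.1 hx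
  obtain ⟨hyZ, hyx⟩ := Finset.mem_filter.1 hy
  obtain ⟨hzZ, hzx⟩ := Finset.mem_filter.1 hz
  clear hx hy hz
  obtain ⟨x', hx', hix, hlx, hx⟩ := exists_origin_of_mem_exitTerminals hmX hm hxZ
  obtain ⟨y', hy', hiy, hly, hy⟩ := exists_origin_of_mem_exitTerminals hmX hm hyZ
  obtain ⟨z', hz', hiz, hlz, hz⟩ := exists_origin_of_mem_exitTerminals hmX hm hzZ
  rw [hyx] at hiy
  rw [hzx] at hiz
  rw [← hxy] at hly
  rw [← hxz] at hlz
  by_cases hcross : ∃ s ∈ crossing X σ i, s i = x i ∧ l s = m x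
  · -- all three are the crossing terminal `s` or its exit vertex
    obtain ⟨s, hs, his, hls⟩ := hcross
    have heq : ∀ {w}, w ∈ X → w i = x i → l w = m x → w = s := fun hw hwi hwl =>
      hσ.eq_of_crossing hs hw (hwl.trans hls.symm) (hwi.trans his.symm)
    obtain rfl := heq hx' hix hlx
    obtain rfl := heq hy' hiy hly
    obtain rfl := heq hz' hiz hlz
    grind
  · push Not at hcross
    obtain rfl := hx.resolve_right fun h => hcross x' h.1 hix hlx
    obtain rfl := hy.resolve_right fun h => hcross y' h.1 hiy hly
    obtain rfl := hz.resolve_right fun h => hcross z' h.1 hiz hlz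
    exact hσ.pairLabelled x hx' y hy' z hz' (hlx.trans hly.symm) (hlx.trans hlz.symm)

theorem IsPartner.card_exitTerminals_filter_le (hσ : IsPartner X l σ) (b : Bool) :
    {z ∈ exitTerminals X l σ i e | z i = b}.card ≤ {x ∈ X | x i = b}.card +
      {w ∈ X | ¬ w i = b ∧ w ∈ crossing X σ i ∧ exitVertex l i e (σ w) ≠ σ w}.card := by
  have hsub : {z ∈ exitTerminals X l σ i e | z i = b} ⊆ {x ∈ X | x i = b} ∪
      {w ∈ X | ¬ w i = b ∧ w ∈ crossing X σ i ∧ exitVertex l i e (σ w) ≠ σ w}.image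
        (fun w => exitVertex l i e (σ w)) := by
    intro z hz
    obtain ⟨hzZ, rfl⟩ := Finset.mem_filter.1 hz
    by_cases hzX : z ∈ X
    · exact Finset.mem_union_left _ (by simp [hzX])
    · obtain ⟨s, hs, rfl⟩ := Finset.mem_image.1 ((Finset.mem_union.1 hzZ).resolve_left hzX)
      obtain ⟨hsX, hsi⟩ := mem_crossing.1 hs
      refine Finset.mem_union_right _ (Finset.mem_image.2 ⟨σ s, ?_, by rw [hσ.invol s hsX]⟩)
      rw [exitVertex_apply_same, Finset.mem_filter, hσ.invol s hsX]
      exact ⟨hσ.mem s hsX, hsi, hσ.partner_mem_crossing hs, fun h => hzX (by rwa [h])⟩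
  exact ((Finset.card_le_card hsub).trans (Finset.card_union_le _ _)).trans
    (Nat.add_le_add_left Finset.card_image_le _)

/-- Each vertex of `X` in one facet accounts for at most one new terminal in the opposite facet, and
`w` accounts for none, so neither facet gets more than `d + 1` terminals. -/
theorem CubeLinked.linkable_of_isExit {l : (Fin (d + 1) → Bool) → ℕ} {e : ℕ → Fin d → Bool}
    (hd : CubeLinked d) (hσ : IsPartner X l σ) (hX : X.card ≤ d + 2) (he : IsExit X l σ i e)
    (hload : ∀ b, X.card ≤ d + 1 ∨
      ∃ w ∈ X, w i ≠ b ∧ (w ∈ crossing X σ i → exitVertex l i e (σ w) = σ w)) :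
    Linkable (cubeGraph (d + 1)) Set.univ X l := by
  obtain ⟨m, hmX, hm⟩ := he.exists_label
  have hcard : ∀ b, {z ∈ exitTerminals X l σ i e | z i = b}.card ≤ d + 1 := fun b => by
    refine (hσ.card_exitTerminals_filter_le b).trans ?_
    have hsub : {w ∈ X | ¬ w i = b ∧ w ∈ crossing X σ i ∧ exitVertex l i e (σ w) ≠ σ w} ⊆
        {w ∈ X | ¬ w i = b} := Finset.monotone_filter_right _ fun _ _ h => h.1
    have hsum := Finset.card_filter_add_card_filter_not (s := X) (fun z => z i = b)
    rcases hload b with hX' | ⟨w, hw, hwb, hexit⟩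
    · have := Finset.card_le_card hsub
      omega
    · have hlt := Finset.card_lt_card (hsub.ssubset_of_mem_notMem (a := w) (by simp [hw, hwb])
        fun h => (Finset.mem_filter.1 h).2.2.2 (hexit (Finset.mem_filter.1 h).2.2.1))
      omega
  obtain ⟨c, hc, hreach⟩ := hd.exists_coloring_of_facets i hcard
    (hσ.pairLabelled_exitTerminals hmX hm)
  have hXZ : X ⊆ exitTerminals X l σ i e := Finset.subset_union_left
  have toExit : ∀ s ∈ crossing X σ i,
      (monochromaticOn (cubeGraph (d + 1)) c Set.univ).Reachable s (exitVertex l i e s) :=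
    fun s hs => hreach s (hXZ (mem_crossing.1 hs).1) _ (exitVertex_mem_exitTerminals hs)
      (exitVertex_apply_same s).symm (by rw [hmX s (mem_crossing.1 hs).1, hm s hs])
  refine ⟨c, fun x hx => by rw [hc x (hXZ hx), hmX x hx], fun x hx y hy hxy => ?_⟩
  by_cases hi : x i = y i
  · exact hreach x (hXZ hx) y (hXZ hy) hi (by rw [hmX x hx, hmX y hy, hxy])
  · obtain rfl := hσ.eq_of_label_eq hx hy hxy fun h => hi (h ▸ rfl)
    have hxK : x ∈ crossing X σ i := mem_crossing.2 ⟨hx, Ne.symm hi⟩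
    have hyK := hσ.partner_mem_crossing hxK
    refine ((toExit x hxK).trans (SimpleGraph.Adj.reachable ⟨?_, ?_, trivial, trivial⟩)).trans
      (toExit _ hyK).symm
    · rw [hσ.exitVertex_partner hxK]
      exact cubeGraph_adj_flipAt _ _
    · rw [hc _ (exitVertex_mem_exitTerminals hxK), hc _ (exitVertex_mem_exitTerminals hyK),
        hm x hxK, hm _ hyK, hσ.label x hx]

end Exits

section Released

variable {ι : Type*} {d : ℕ} {X R : Finset (Fin (d + 1) → Bool)} {l : (Fin (d + 1) → Bool) → ι}
  {σ : (Fin (d + 1) → Bool) → (Fin (d + 1) → Bool)} {i : Fin (d + 1)}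

theorem two_mul_add_two_le_two_pow (hd : 4 ≤ d) : 2 * (d + 2) ≤ 2 ^ d := by
  induction d, hd using Nat.le_induction with
  | base => norm_num
  | succ n _ ih => rw [pow_succ]; omega

theorem exists_edges_avoiding [DecidableEq ι] (hd : 4 ≤ d) (hX : X.card ≤ d + 2)
    (l : (Fin (d + 1) → Bool) → ι) (i : Fin (d + 1)) :
    ∃ g : ι → Fin d → Bool, Set.InjOn g (X.image l) ∧
      ∀ k ∈ X.image l, ∀ x ∈ X, i.removeNth x ≠ g k := by
  have hle : (X.image l).card ≤ (X.image i.removeNth)ᶜ.card := by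
    have := two_mul_add_two_le_two_pow hd
    have := Finset.card_image_le (s := X) (f := l)
    have := Finset.card_image_le (s := X) (f := i.removeNth)
    have : Fintype.card (Fin d → Bool) = 2 ^ d := by simp
    rw [Finset.card_compl]
    omega
  obtain ⟨g, hg, hinj⟩ := (X.image l).finite_toSet.exists_injOn_of_encard_le
    (t := SetLike.coe (X.image i.removeNth)ᶜ)
    (by simpa only [Set.encard_coe_eq_coe_finsetCard, Nat.cast_le] using hle)
  exact ⟨g, hinj, fun k hk x hx h => Finset.mem_compl.1 (hg hk)
    (Finset.mem_image.2 ⟨x, hx, h⟩)⟩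

theorem IsPartner.isExit_of_eq_removeNth [DecidableEq ι] (hσ : IsPartner X l σ) (hRX : R ⊆ X)
    (hR : ∀ a ∈ R, flipAt a i ∈ X → flipAt a i = σ a) {e g : ι → Fin d → Bool}
    (hg : Set.InjOn g (X.image l)) (hgX : ∀ k ∈ X.image l, ∀ x ∈ X, i.removeNth x ≠ g k)
    (heR : ∀ a ∈ R, e (l a) = i.removeNth a) (heg : ∀ k ∉ R.image l, e k = g k) :
    IsExit X l σ i e where
  label_eq s hs t ht h := by
    have hs := Finset.mem_image_of_mem l (mem_crossing.1 hs).1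
    have ht := Finset.mem_image_of_mem l (mem_crossing.1 ht).1
    by_cases hsR : l s ∈ R.image l <;> by_cases htR : l t ∈ R.image l
    · obtain ⟨a, ha, hla⟩ := Finset.mem_image.1 hsR
      obtain ⟨b, hb, hlb⟩ := Finset.mem_image.1 htR
      rw [← hla, ← hlb, heR a ha, heR b hb] at h
      rcases eq_or_eq_flipAt_of_removeNth_eq h with rfl | rfl
      · exact hla.symm.trans hlb
      · rw [← hla, ← hlb, hR a ha (hRX hb), hσ.label a (hRX ha)]
    · obtain ⟨a, ha, hla⟩ := Finset.mem_image.1 hsR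
      rw [← hla, heR a ha, heg _ htR] at h
      exact absurd h (hgX _ ht a (hRX ha))
    · obtain ⟨b, hb, hlb⟩ := Finset.mem_image.1 htR
      rw [← hlb, heR b hb, heg _ hsR] at h
      exact absurd h.symm (hgX _ hs b (hRX hb))
    · rw [heg _ hsR, heg _ htR] at h
      exact hg hs ht h
  eq_self s hs hsX := by
    have hproj : i.removeNth (exitVertex l i e s) = e (l s) := removeNth_facetEmbedding i _ _
    refine hσ.eq_of_crossing hs hsX ?_ (exitVertex_apply_same s)
    by_cases hsR : l s ∈ R.image l
    · obtain ⟨a, ha, hla⟩ := Finset.mem_image.1 hsR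
      rw [← hla, heR a ha] at hproj
      rcases eq_or_eq_flipAt_of_removeNth_eq hproj.symm with h | h
      · rw [h, hla]
      · rw [h] at hsX ⊢
        rw [hR a ha hsX, hσ.label a (hRX ha), hla]
    · rw [heg _ hsR] at hproj
      exact absurd hproj (hgX _ (Finset.mem_image_of_mem l (mem_crossing.1 hs).1) _ hsX)

theorem IsPartner.exists_isExit (hd : 4 ≤ d) (hσ : IsPartner X l σ) (hX : X.card ≤ d + 2)
    (hRX : R ⊆ X) (hinj : Set.InjOn l R)
    (hR : ∀ a ∈ R, flipAt a i ∈ X → flipAt a i = σ a) :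
    ∃ e, IsExit X l σ i e ∧ ∀ a ∈ R, exitVertex l i e a = a := by
  classical
  obtain ⟨g, hg, hgX⟩ := exists_edges_avoiding hd hX l i
  let e k := if k ∈ R.image l then i.removeNth (Function.invFunOn l R k) else g k
  have heR : ∀ a ∈ R, e (l a) = i.removeNth a := fun a ha => by
    simp only [e, Finset.mem_image_of_mem l ha, if_true]
    rw [hinj.leftInvOn_invFunOn ha]
  refine ⟨e, hσ.isExit_of_eq_removeNth hRX hR hg hgX heR fun k hk => if_neg hk, fun a ha => ?_⟩
  rw [exitVertex, heR a ha, facetEmbedding_removeNth rfl]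

theorem CubeLinked.linkable_of_released {l : (Fin (d + 1) → Bool) → ℕ} (hcube : CubeLinked d)
    (hd : 4 ≤ d) (hσ : IsPartner X l σ) (hX : X.card ≤ d + 2) (hRX : R ⊆ X) (hinj : Set.InjOn l R)
    (hR : ∀ a ∈ R, flipAt a i ∈ X → flipAt a i = σ a)
    (hload : ∀ b, X.card ≤ d + 1 ∨
      ∃ w ∈ X, w i ≠ b ∧ (σ w i = w i ∨ σ w ∈ R ∨ w ∈ R ∧ flipAt w i = σ w)) :
    Linkable (cubeGraph (d + 1)) Set.univ X l := by
  obtain ⟨e, he, heR⟩ := hσ.exists_isExit hd hX hRX hinj hR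
  refine hcube.linkable_of_isExit hσ hX he fun b => (hload b).imp_right ?_
  rintro ⟨w, hw, hwb, hstay | hsrc | ⟨hwR, hflip⟩⟩
  · exact ⟨w, hw, hwb, fun h => absurd hstay (mem_crossing.1 h).2⟩
  · exact ⟨w, hw, hwb, fun _ => heR _ hsrc⟩
  · exact ⟨w, hw, hwb, fun h => by rw [hσ.exitVertex_partner h, heR w hwR, hflip]⟩

end Released

section Detour

variable {V ι : Type*} {G : SimpleGraph V} {c l : V → ι} {A : Set V} {v : V}

theorem exists_reachable_sdiff_of_reachable {s : V} (h : (monochromaticOn G c A).Reachable s v)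
    (hs : s ≠ v) :
    ∃ a, (monochromaticOn G c A).Adj a v ∧ (monochromaticOn G c (A \ {v})).Reachable s a := by
  obtain ⟨w⟩ := h
  induction w with
  | nil => exact absurd rfl hs
  | @cons s u v h p ih =>
    by_cases hu : u = v
    · subst hu
      exact ⟨s, h, .refl _⟩
    · obtain ⟨a, ha, hr⟩ := ih hu
      have hsu : (monochromaticOn G c (A \ {v})).Adj s u :=
        ⟨h.1, h.2.1, ⟨h.2.2.1, hs⟩, ⟨h.2.2.2, hu⟩⟩
      exact ⟨a, ha, hsu.reachable.trans hr⟩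

theorem reachable_sdiff_of_not_reachable {s t : V} (h : (monochromaticOn G c A).Reachable s t)
    (hv : ¬ (monochromaticOn G c A).Reachable s v) :
    (monochromaticOn G c (A \ {v})).Reachable s t := by
  obtain ⟨w⟩ := h
  induction w with
  | nil => exact .refl _
  | @cons s u t h _ ih =>
    have hu : ¬ (monochromaticOn G c A).Reachable u v := fun hr => hv (h.reachable.trans hr)
    have hsu : (monochromaticOn G c (A \ {v})).Adj s u := by
      refine ⟨h.1, h.2.1, ⟨h.2.2.1, ?_⟩, ⟨h.2.2.2, ?_⟩⟩
      · rintro rfl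
        exact hv (.refl _)
      · rintro rfl
        exact hu (.refl _)
    exact hsu.reachable.trans (ih hu)

theorem exists_interruption {Y : Finset V} (hl : PairLabelled Y l) (hc : ∀ y ∈ Y, c y = l y)
    (hreach : ∀ x ∈ Y, ∀ y ∈ Y, l x = l y → (monochromaticOn G c A).Reachable x y) (hv : v ∉ Y) :
    ∃ W : Finset V, W.card ≤ 2 ∧
      (∀ w ∈ W, w ∈ A ∧ w ≠ v ∧ c w = c v ∧ ∃ y ∈ Y, l y = c v) ∧
      ∀ x ∈ Y, ∀ y ∈ Y, l x = l y → (monochromaticOn G c (A \ {v})).Reachable x y ∨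
        ∃ a ∈ W, ∃ a' ∈ W, (monochromaticOn G c (A \ {v})).Reachable x a ∧
          (monochromaticOn G c (A \ {v})).Reachable y a' := by
  classical
  have hne : ∀ y ∈ Y, y ≠ v := fun y hy h => hv (h ▸ hy)
  have : Nonempty V := ⟨v⟩
  choose! N hadj hN using fun (y : V) (hy : y ∈ Y) (h : (monochromaticOn G c A).Reachable y v) =>
    exists_reachable_sdiff_of_reachable h (hne y hy)
  refine ⟨{y ∈ Y | (monochromaticOn G c A).Reachable y v}.image N, ?_, ?_, ?_⟩
  · refine Finset.card_image_le.trans ((Finset.card_le_card fun y hy => ?_).trans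
      (hl.card_filter_le_two (c v)))
    rw [Finset.mem_filter] at hy ⊢
    exact ⟨hy.1, (hc y hy.1).symm.trans (color_eq_of_reachable hy.2)⟩
  · simp only [Finset.forall_mem_image, Finset.mem_filter]
    rintro y ⟨hy, hr⟩
    have h := hadj y hy hr
    exact ⟨h.2.2.1, h.1.ne, h.2.1, y, hy, (hc y hy).symm.trans (color_eq_of_reachable hr)⟩
  · intro x hx y hy hxy
    by_cases hr : (monochromaticOn G c A).Reachable x v
    · have hr' := (hreach x hx y hy hxy).symm.trans hr
      exact Or.inr ⟨N x, Finset.mem_image_of_mem N (by simp [hx, hr]), N y,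
        Finset.mem_image_of_mem N (by simp [hy, hr']), hN x hx hr, hN y hy hr'⟩
    · exact Or.inl (reachable_sdiff_of_not_reachable (hreach x hx y hy hxy) hr)

theorem pairLabelled_insert_insert_union [DecidableEq V] {s t : V} {W : Finset V} {l : V → ι}
    (hW : W.card ≤ 2) (h : ∀ w ∈ W, l w ≠ l s) (hst : l t = l s) :
    PairLabelled ({s, t} ∪ W) l :=
  (PairLabelled.of_card_le_two Finset.card_le_two l).union (.of_card_le_two hW l)
    fun u hu w hw huw => h w hw (by
      rcases Finset.mem_insert.1 hu with rfl | hu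
      · exact huw.symm
      · rw [← huw, Finset.mem_singleton.1 hu, hst])

/-- All terminals but one, `t`, are linked inside `A`. Only the connection through `t` is
interrupted; its two loose ends next to `t`, and `t` with its partner, form the set `Z`. -/
theorem exists_coloring_with_gaps [DecidableEq V] {X : Finset V} (hl : PairLabelled X l)
    (hXA : ∀ x ∈ X, x ∈ A) (hlink : ∀ t ∈ X, Linkable G A (X.erase t) l) :
    ∃ (c : V → ι) (Z : Finset V), (∀ x ∈ X, c x = l x) ∧ Z.card ≤ 4 ∧ (∀ z ∈ Z, z ∈ A) ∧
      PairLabelled Z c ∧ ∀ x ∈ X, ∀ y ∈ X, l x = l y → (monochromaticOn G c A).Reachable x y ∨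
        ∃ a ∈ Z, ∃ a' ∈ Z, c a = c a' ∧ (monochromaticOn G c A).Reachable x a ∧
          (monochromaticOn G c A).Reachable y a' := by
  by_cases hinj : ∀ x ∈ X, ∀ y ∈ X, l x = l y → x = y
  · exact ⟨l, ∅, by simp, by simp, by simp, by simp [PairLabelled],
      fun x hx y hy hxy => Or.inl (hinj x hx y hy hxy ▸ .refl _)⟩
  push Not at hinj
  obtain ⟨s, hs, t, ht, hst, hne⟩ := hinj
  have hY : (X.erase t).erase s ⊆ X.erase t := Finset.erase_subset s _
  obtain ⟨c, hc, hreach⟩ := hlink t ht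
  obtain ⟨W, hWcard, hW, hdetour⟩ := exists_interruption (hl.subset (hY.trans (X.erase_subset t)))
    (fun y hy => hc y (hY hy)) (fun x hx y hy => hreach x (hY hx) y (hY hy))
    (v := t) (fun h => Finset.notMem_erase t X (hY h))
  have honly : ∀ y ∈ X, l y = l s → y = s ∨ y = t := fun y hy h => by
    have := hl s hs t ht y hy hst h.symm
    tauto
  obtain ⟨c', hc'X, hc'⟩ : ∃ c' : V → ι, (∀ x ∈ X, c' x = l x) ∧ ∀ u, u ≠ t → c' u = c u :=
    ⟨Function.update c t (l t), fun x hx => by grind [Function.update_apply],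
      fun u hu => Function.update_of_ne hu _ c⟩
  have hc'W : ∀ w ∈ W, c' w = c t := fun w hw => by rw [hc' w (hW w hw).2.1, (hW w hw).2.2.1]
  have inA : monochromaticOn G c (A \ {t}) ≤ monochromaticOn G c' A :=
    monochromaticOn_le Set.sdiff_subset fun u hu => (hc' u hu.2).symm
  refine ⟨c', {s, t} ∪ W, hc'X, (Finset.card_union_le _ _).trans
    (Nat.add_le_add Finset.card_le_two hWcard), ?_,
    pairLabelled_insert_insert_union hWcard ?_ ?_, fun x hx y hy hxy => ?_⟩
  · grind
  · intro w hw h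
    obtain ⟨y, hy, hly⟩ := (hW w hw).2.2.2
    grind
  · rw [hc'X t ht, hc'X s hs, hst]
  · by_cases hxs : l x = l s
    · exact Or.inr ⟨x, by grind, y, by grind, by rw [hc'X x hx, hc'X y hy, hxy],
        .refl _, .refl _⟩
    · refine (hdetour x (by grind) y (by grind) hxy).imp (·.mono inA) ?_
      rintro ⟨a, ha, a', ha', hxa, hya⟩
      exact ⟨a, by grind, a', by grind, by rw [hc'W a ha, hc'W a' ha'], hxa.mono inA, hya.mono inA⟩

end Detour

section Facet

variable {d : ℕ}

theorem CubeLinked.exists_coloring_through_opposite (hcube : CubeLinked d) (i : Fin (d + 1))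
    (b : Bool) {Z : Finset (Fin (d + 1) → Bool)} {c : (Fin (d + 1) → Bool) → ℕ}
    (hZ : ∀ z ∈ Z, z i = b) (hcard : Z.card ≤ d + 1) (hc : PairLabelled Z c) :
    ∃ c' : (Fin (d + 1) → Bool) → ℕ, Set.EqOn c' c {u | u i = b} ∧
      ∀ z ∈ Z, ∀ w ∈ Z, c z = c w →
        (monochromaticOn (cubeGraph (d + 1)) c' Set.univ).Reachable z w := by
  let flip (z : Fin (d + 1) → Bool) := flipAt z i
  have hpair : PairLabelled (Z.image flip) (c ∘ flip) := by
    unfold PairLabelled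
    simp only [Finset.forall_mem_image, Function.comp_apply, flip, flipAt_flipAt,
      (flipAt_left_injective i).eq_iff]
    exact fun x hx y hy z hz => hc x hx y hy z hz
  obtain ⟨c₁, hc₁, hreach⟩ := hcube.linkable_facet i (!b)
    (Finset.forall_mem_image.2 fun z hz => (flipAt_same z i).trans (by rw [hZ z hz]))
    (Finset.card_image_le.trans hcard) hpair
  simp only [Finset.forall_mem_image, Function.comp_apply, flip, flipAt_flipAt] at hc₁ hreach
  let c' (u : Fin (d + 1) → Bool) := if u i = b then c u else c₁ u
  have hc'b : ∀ u, u i = b → c' u = c u := fun u hu => if_pos hu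
  have hc' : ∀ u, u i = (!b) → c' u = c₁ u := fun u hu => if_neg (by simp [hu])
  have toOpposite : ∀ z ∈ Z,
      (monochromaticOn (cubeGraph (d + 1)) c' Set.univ).Reachable z (flipAt z i) := fun z hz =>
    SimpleGraph.Adj.reachable ⟨cubeGraph_adj_flipAt z i, by
      rw [hc'b z (hZ z hz), hc' _ (by rw [flipAt_same, hZ z hz]), hc₁ hz], trivial, trivial⟩
  refine ⟨c', hc'b, fun z hz w hw hzw => ?_⟩
  exact ((toOpposite z hz).trans ((hreach hz hw hzw).mono
    (monochromaticOn_le (Set.subset_univ _) fun u hu => (hc' u hu).symm))).trans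
    (toOpposite w hw).symm

theorem CubeLinked.linkable_of_facet (hcube : CubeLinked d) (hd : 3 ≤ d)
    {X : Finset (Fin (d + 1) → Bool)} {l : (Fin (d + 1) → Bool) → ℕ} (hl : PairLabelled X l)
    (hX : X.card ≤ d + 2) (i : Fin (d + 1)) (b : Bool) (hXb : ∀ x ∈ X, x i = b) :
    Linkable (cubeGraph (d + 1)) Set.univ X l := by
  obtain ⟨c, Z, hcX, hZcard, hZb, hZ, hgaps⟩ := exists_coloring_with_gaps hl
    (A := {x : Fin (d + 1) → Bool | x i = b}) hXb fun t ht =>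
      hcube.linkable_facet i b (fun y hy => hXb y (Finset.mem_of_mem_erase hy))
      (by rw [Finset.card_erase_of_mem ht]; omega) (hl.subset (Finset.erase_subset t X))
  obtain ⟨c', hc', hreach⟩ := hcube.exists_coloring_through_opposite i b hZb (by omega) hZ
  have hle := monochromaticOn_le (G := cubeGraph (d + 1)) (Set.subset_univ _) hc'.symm
  refine ⟨c', fun x hx => (hc' (hXb x hx)).trans (hcX x hx), fun x hx y hy hxy => ?_⟩
  rcases hgaps x hx y hy hxy with h | ⟨a, ha, a', ha', haa', hxa, hya⟩
  · exact h.mono hle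
  · exact ((hxa.mono hle).trans (hreach a ha a' ha' haa')).trans (hya.mono hle).symm

end Facet

section EdgeDirections

theorem card_filter_add_card_filter_apply_eq_not {α : Type*} (X : Finset (α → Bool)) (i : α)
    (b : Bool) : {x ∈ X | x i = b}.card + {x ∈ X | x i = !b}.card = X.card := by
  simp only [Bool.eq_not, Finset.card_filter_add_card_filter_not, ne_eq]

variable {α : Type*} [DecidableEq α] [Fintype α] {X : Finset (α → Bool)} {i : α}

/-- The directions of the cube edges with both ends in `X`. -/
def edgeDirections (X : Finset (α → Bool)) : Finset α :=
  {i | ∃ x ∈ X, flipAt x i ∈ X}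

theorem mem_edgeDirections : i ∈ edgeDirections X ↔ ∃ x ∈ X, flipAt x i ∈ X := by
  simp [edgeDirections]

theorem exists_mem_apply_eq_of_mem_edgeDirections (hi : i ∈ edgeDirections X) (b : Bool) :
    ∃ x ∈ X, x i = b := by
  obtain ⟨x, hx, hflip⟩ := mem_edgeDirections.1 hi
  by_cases hb : x i = b
  · exact ⟨x, hx, hb⟩
  · exact ⟨_, hflip, by rw [flipAt_same, Bool.not_eq.2 hb]⟩

theorem edgeDirections_filter_union_filter (X : Finset (α → Bool)) (i : α) (b : Bool) :
    edgeDirections {x ∈ X | x i = b} ∪ edgeDirections {x ∈ X | x i = !b} =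
      (edgeDirections X).erase i := by
  ext j
  simp only [Finset.mem_union, Finset.mem_erase, mem_edgeDirections, Finset.mem_filter]
  constructor
  · rintro (⟨x, ⟨hx, hxi⟩, hflip, hflipi⟩ | ⟨x, ⟨hx, hxi⟩, hflip, hflipi⟩) <;>
      exact ⟨fun h => by simp [h, hxi] at hflipi, x, hx, hflip⟩
  · rintro ⟨hji, x, hx, hflip⟩
    have hxi : flipAt x j i = x i := flipAt_of_ne x hji.symm
    by_cases hb : x i = b
    · exact Or.inl ⟨x, ⟨hx, hb⟩, hflip, hxi.trans hb⟩
    · exact Or.inr ⟨x, ⟨hx, Bool.eq_not.2 hb⟩, hflip, hxi.trans (Bool.eq_not.2 hb)⟩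

theorem card_edgeDirections_lt (hX : X.Nonempty) : (edgeDirections X).card < X.card := by
  induction X using Finset.strongInduction with
  | H X ih =>
    obtain hempty | ⟨i, hi⟩ := (edgeDirections X).eq_empty_or_nonempty
    · rw [hempty, Finset.card_empty]
      exact hX.card_pos
    have hside : ∀ b, (edgeDirections {x ∈ X | x i = b}).card < {x ∈ X | x i = b}.card :=
      fun b => by
        obtain ⟨x, hx, hxb⟩ := exists_mem_apply_eq_of_mem_edgeDirections hi b
        obtain ⟨y, hy, hyb⟩ := exists_mem_apply_eq_of_mem_edgeDirections hi (!b)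
        exact ih _ (Finset.filter_ssubset.2 ⟨y, hy, by simp [hyb]⟩) ⟨x, by simp [hx, hxb]⟩
    have hunion := Finset.card_union_le (edgeDirections {x ∈ X | x i = true})
      (edgeDirections {x ∈ X | x i = !true})
    rw [edgeDirections_filter_union_filter, Finset.card_erase_of_mem hi] at hunion
    have hcard := card_filter_add_card_filter_apply_eq_not X i true
    have htrue := hside true
    have hfalse := hside !true
    omega

theorem card_edgeDirections_add_two_le (hi : i ∉ edgeDirections X)
    (hX : ∀ b, ∃ x ∈ X, x i = b) : (edgeDirections X).card + 2 ≤ X.card := by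
  have hside : ∀ b, (edgeDirections {x ∈ X | x i = b}).card < {x ∈ X | x i = b}.card := fun b => by
    obtain ⟨x, hx, hxb⟩ := hX b
    exact card_edgeDirections_lt ⟨x, by simp [hx, hxb]⟩
  have hunion := Finset.card_union_le (edgeDirections {x ∈ X | x i = true})
    (edgeDirections {x ∈ X | x i = !true})
  rw [edgeDirections_filter_union_filter, Finset.erase_eq_of_notMem hi] at hunion
  have hcard := card_filter_add_card_filter_apply_eq_not X i true
  have htrue := hside true
  have hfalse := hside !true
  omega

theorem exists_card_filter_lt_of_edgeDirections_eq_univ (hX : X.card = Fintype.card α + 1)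
    (huniv : edgeDirections X = Finset.univ) (i : α) (b : Bool)
    (hib : 2 ≤ {x ∈ X | x i = b}.card) :
    ∃ j b', {x ∈ X | x j = b'}.card < {x ∈ X | x i = b}.card := by
  set S := {x ∈ X | x i = b}
  set T := {x ∈ X | x i = !b} with hT
  have hSlt : (edgeDirections S).card < S.card :=
    card_edgeDirections_lt (Finset.card_pos.1 (by omega))
  have hTlt : (edgeDirections T).card < T.card := by
    obtain ⟨x, hx, hxb⟩ := exists_mem_apply_eq_of_mem_edgeDirections
      (huniv ▸ Finset.mem_univ i) (!b)
    exact card_edgeDirections_lt ⟨x, by simp [hT, hx, hxb]⟩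
  have hunion := Finset.card_union_add_card_inter (edgeDirections S) (edgeDirections T)
  rw [edgeDirections_filter_union_filter, huniv, Finset.card_erase_of_mem (Finset.mem_univ i),
    Finset.card_univ] at hunion
  have hST : S.card + T.card = X.card := card_filter_add_card_filter_apply_eq_not X i b
  obtain ⟨j, hjS⟩ : (edgeDirections S).Nonempty := Finset.card_pos.1 (by omega)
  have hjT : j ∉ edgeDirections T := fun hjT => by
    have := Finset.card_pos.2 ⟨j, Finset.mem_inter.2 ⟨hjS, hjT⟩⟩
    omega
  obtain ⟨b', hb'⟩ : ∃ b', ∀ x ∈ T, x j ≠ b' := by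
    by_contra! h
    have := card_edgeDirections_add_two_le hjT h
    omega
  refine ⟨j, b', Finset.card_lt_card ⟨fun x hx => ?_, fun h => ?_⟩⟩
  · obtain ⟨hxX, hxj⟩ := Finset.mem_filter.1 hx
    by_contra hxS
    exact hb' x (Finset.mem_filter.2 ⟨hxX, Bool.eq_not.2 fun h => hxS (by simp [S, hxX, h])⟩) hxj
  · obtain ⟨x, hx, hxj⟩ := exists_mem_apply_eq_of_mem_edgeDirections hjS (!b')
    exact absurd (Finset.mem_filter.1 (h hx)).2 (by simp [hxj])

theorem exists_card_filter_eq_one_of_edgeDirections_eq_univ [Nonempty α]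
    (hX : X.card = Fintype.card α + 1) (huniv : edgeDirections X = Finset.univ) :
    ∃ i b, {x ∈ X | x i = b}.card = 1 := by
  obtain ⟨⟨i, b⟩, hmin⟩ := Finite.exists_min fun p : α × Bool => {x ∈ X | x p.1 = p.2}.card
  refine ⟨i, b, le_antisymm (not_lt.1 fun h => ?_) ?_⟩
  · obtain ⟨j, b', hlt⟩ := exists_card_filter_lt_of_edgeDirections_eq_univ hX huniv i b h
    exact hlt.not_ge (hmin (j, b'))
  · obtain ⟨x, hx, hxb⟩ := exists_mem_apply_eq_of_mem_edgeDirections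
      (huniv ▸ Finset.mem_univ i) b
    exact Finset.card_pos.2 ⟨x, by simp [hx, hxb]⟩

end EdgeDirections

section Obstruction

variable {ι : Type*} {d : ℕ} {X : Finset (Fin d → Bool)} {l : (Fin d → Bool) → ι}
  {σ : (Fin d → Bool) → (Fin d → Bool)}

/-- The configurations in which no direction `i` lets the crossing pairs change sides along edges
in direction `i` without overloading one of the two facets. -/
structure IsObstruction (X : Finset (Fin d → Bool)) (σ : (Fin d → Bool) → (Fin d → Bool)) :
    Prop where
  exists_mem : ∀ i b, ∃ x ∈ X, x i = b
  same_side : ∀ i, ∀ x ∈ X, ∀ y ∈ X, σ x i = x i → σ y i = y i → x i = y i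
  flip_mem : ∀ i, ∀ x ∈ X, σ x i = x i → ∀ s ∈ crossing X σ i, s i = x i → flipAt s i ∈ X
  flip_ne : ∀ i, ∀ s ∈ X, flipAt s i ≠ σ s
  flip_mem_or : ∀ i, ∀ s ∈ crossing X σ i, ∀ t ∈ crossing X σ i, s i ≠ t i → t ≠ σ s →
    flipAt s i ∈ X ∨ flipAt t i ∈ X

theorem IsPartner.exists_crossing_apply_eq (hσ : IsPartner X l σ) {i : Fin d} {s : Fin d → Bool}
    (hs : s ∈ crossing X σ i) (b : Bool) : ∃ t ∈ crossing X σ i, (t = s ∨ t = σ s) ∧ t i = b := by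
  by_cases hb : s i = b
  · exact ⟨s, hs, Or.inl rfl, hb⟩
  · refine ⟨σ s, hσ.partner_mem_crossing hs, Or.inr rfl, ?_⟩
    rw [Bool.eq_not_iff.2 (mem_crossing.1 hs).2, Bool.not_eq.2 hb]

namespace IsObstruction

theorem mem_edgeDirections (h : IsObstruction X σ) (hσ : IsPartner X l σ) (hX : 3 ≤ X.card)
    (i : Fin d) : i ∈ edgeDirections X := by
  rw [_root_.mem_edgeDirections]
  by_cases hstay : ∃ x ∈ X, σ x i = x i
  · obtain ⟨x, hx, hxi⟩ := hstay
    obtain ⟨y, hy, hyi⟩ := h.exists_mem i (!x i)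
    have hyK : y ∈ crossing X σ i := mem_crossing.2 ⟨hy, fun hstay =>
      absurd (h.same_side i x hx y hy hxi hstay) (by simp [hyi])⟩
    obtain ⟨s, hs, -, hsi⟩ := hσ.exists_crossing_apply_eq hyK (x i)
    exact ⟨s, (mem_crossing.1 hs).1, h.flip_mem i x hx hxi s hs hsi⟩
  · push Not at hstay
    have hall : ∀ x ∈ X, x ∈ crossing X σ i := fun x hx => mem_crossing.2 ⟨hx, hstay x hx⟩
    obtain ⟨s, hs⟩ := Finset.card_pos.1 (by omega : 0 < X.card)
    obtain ⟨t, ht, htne⟩ := Finset.exists_mem_notMem_of_card_lt_card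
      (Finset.card_le_two.trans_lt hX : ({s, σ s} : Finset _).card < X.card)
    obtain ⟨t', ht', htt', hti⟩ := hσ.exists_crossing_apply_eq (hall t ht) (!s i)
    have hne : t' ≠ σ s := by
      rintro rfl
      rcases htt' with h | h
      · grind
      · have := congrArg σ h
        rw [hσ.invol s hs, hσ.invol t ht] at this
        grind
    rcases h.flip_mem_or i s (hall s hs) t' ht' (by simp [hti]) hne with hflip | hflip
    exacts [⟨s, hs, hflip⟩, ⟨t', (mem_crossing.1 ht').1, hflip⟩]

theorem card_filter_ne_one (h : IsObstruction X σ) (hσ : IsPartner X l σ) (hX : 3 ≤ X.card)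
    (i : Fin d) (b : Bool) : {x ∈ X | x i = b}.card ≠ 1 := fun hone => by
  obtain ⟨v, hv⟩ := Finset.card_eq_one.1 hone
  have hvX : v ∈ X ∧ v i = b := Finset.mem_filter.1 (hv ▸ Finset.mem_singleton_self v)
  have honly : ∀ x ∈ X, x i = b → x = v := fun x hx hxb =>
    Finset.mem_singleton.1 (hv ▸ Finset.mem_filter.2 ⟨hx, hxb⟩)
  obtain ⟨y, hy, hyne⟩ := Finset.exists_mem_notMem_of_card_lt_card
    (Finset.card_le_two.trans_lt hX : ({v, σ v} : Finset _).card < X.card)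
  rw [Finset.mem_insert, Finset.mem_singleton, not_or] at hyne
  have hyi : y i = !b := Bool.eq_not.2 fun hyb => hyne.1 (honly y hy hyb)
  have hystay : σ y i = y i := by
    rw [hyi, Bool.eq_not]
    intro hyb
    exact hyne.2 (by rw [← honly _ (hσ.mem y hy) hyb, hσ.invol y hy])
  by_cases hvstay : σ v i = v i
  · simpa [hyi, hvX.2] using h.same_side i v hvX.1 y hy hvstay hystay
  · have hvK := hσ.partner_mem_crossing (mem_crossing.2 ⟨hvX.1, hvstay⟩)
    have hvi : σ v i = !b := by rw [← hvX.2, Bool.eq_not_iff.2 hvstay]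
    have hflip := h.flip_mem i y hy hystay (σ v) hvK (hvi.trans hyi.symm)
    refine h.flip_ne i (σ v) (hσ.mem v hvX.1) ?_
    rw [honly _ hflip (by rw [flipAt_same, hvi, Bool.not_not]), hσ.invol v hvX.1]

theorem card_ne (h : IsObstruction X σ) (hσ : IsPartner X l σ) (hd : 2 ≤ d) :
    X.card ≠ d + 1 := fun hX => by
  have : Nonempty (Fin d) := ⟨⟨0, by omega⟩⟩
  obtain ⟨i, b, hib⟩ := exists_card_filter_eq_one_of_edgeDirections_eq_univ
    (by rwa [Fintype.card_fin])
    (Finset.eq_univ_iff_forall.2 (h.mem_edgeDirections hσ (by omega)))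
  exact h.card_filter_ne_one hσ (by omega) i b hib

end IsObstruction

end Obstruction

section Induction

variable {d : ℕ} {X : Finset (Fin (d + 1) → Bool)} {l : (Fin (d + 1) → Bool) → ℕ}
  {σ : (Fin (d + 1) → Bool) → (Fin (d + 1) → Bool)}

theorem CubeLinked.linkable_of_released_pair (hcube : CubeLinked d) (hd : 4 ≤ d)
    (hσ : IsPartner X l σ) (hX : X.card ≤ d + 2) {i : Fin (d + 1)} {s t : Fin (d + 1) → Bool}
    (hs : s ∈ crossing X σ i) (ht : t ∈ crossing X σ i) (hst : s i ≠ t i) (hne : t ≠ σ s)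
    (hsX : flipAt s i ∉ X) (htX : flipAt t i ∉ X) :
    Linkable (cubeGraph (d + 1)) Set.univ X l := by
  obtain ⟨hs, hsi⟩ := mem_crossing.1 hs
  obtain ⟨ht, hti⟩ := mem_crossing.1 ht
  have hts : t ≠ s := fun h => hst (h ▸ rfl)
  have hl : l s ≠ l t := fun h => (hσ.eq_or s hs t ht h).elim hts hne
  refine hcube.linkable_of_released (R := {s, t}) (i := i) hd hσ hX (by grind)
    (by simp [Set.InjOn, hl, hl.symm]) (by grind) fun b => Or.inr ?_
  by_cases hb : s i = b
  · exact ⟨σ s, hσ.mem s hs, hb ▸ hsi, Or.inr (Or.inl (by simp [hσ.invol s hs]))⟩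
  · refine ⟨σ t, hσ.mem t ht, fun h => ?_, Or.inr (Or.inl (by simp [hσ.invol t ht]))⟩
    exact hti (by rw [h, Bool.eq_not_iff.2 hst.symm, Bool.not_eq.2 hb])

theorem CubeLinked.linkable_of_released_singleton (hcube : CubeLinked d) (hd : 4 ≤ d)
    (hσ : IsPartner X l σ) (hX : X.card ≤ d + 2) {i : Fin (d + 1)} {s : Fin (d + 1) → Bool}
    (hs : s ∈ crossing X σ i) (hsX : flipAt s i ∈ X → flipAt s i = σ s)
    (hload : flipAt s i = σ s ∨ ∃ x ∈ X, x i = s i ∧ σ x i = x i) :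
    Linkable (cubeGraph (d + 1)) Set.univ X l := by
  obtain ⟨hs, hsi⟩ := mem_crossing.1 hs
  refine hcube.linkable_of_released (R := {s}) (i := i) hd hσ hX (by simp [hs])
    (by simp) (by simpa using hsX) fun b => Or.inr ?_
  by_cases hb : s i = b
  · exact ⟨σ s, hσ.mem s hs, hb ▸ hsi, Or.inr (Or.inl (by simp [hσ.invol s hs]))⟩
  · rcases hload with hflip | ⟨x, hx, hxs, hxi⟩
    · exact ⟨s, hs, hb, Or.inr (Or.inr ⟨Finset.mem_singleton_self s, hflip⟩)⟩
    · exact ⟨x, hx, hxs ▸ hb, Or.inl hxi⟩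

theorem CubeLinked.isObstruction_of_not_linkable (hcube : CubeLinked d) (hd : 4 ≤ d)
    (hσ : IsPartner X l σ) (hX : X.card ≤ d + 2)
    (h : ¬ Linkable (cubeGraph (d + 1)) Set.univ X l) : IsObstruction X σ where
  exists_mem i b := by
    by_contra! hb
    exact h (hcube.linkable_of_facet (by omega) hσ.pairLabelled hX i (!b)
      fun x hx => Bool.eq_not_iff.2 (hb x hx))
  same_side i x hx y hy hxi hyi := by
    by_contra hxy
    refine h (hcube.linkable_of_released (R := ∅) (i := i) hd hσ hX (by simp) (by simp) (by simp)
      fun b => Or.inr ?_)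
    by_cases hb : x i = b
    · exact ⟨y, hy, fun h => hxy (hb.trans h.symm), Or.inl hyi⟩
    · exact ⟨x, hx, hb, Or.inl hxi⟩
  flip_mem i x hx hxi s hs hsx := by
    by_contra hsX
    exact h (hcube.linkable_of_released_singleton hd hσ hX hs (fun h => absurd h hsX)
      (Or.inr ⟨x, hx, hsx.symm, hxi⟩))
  flip_ne i s hs hflip :=
    h (hcube.linkable_of_released_singleton hd hσ hX
      (mem_crossing.2 ⟨hs, by simp [← hflip]⟩) (fun _ => hflip) (Or.inl hflip))
  flip_mem_or i s hs t ht hst hne := by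
    by_contra! hX'
    exact h (hcube.linkable_of_released_pair hd hσ hX hs ht hst hne hX'.1 hX'.2)

theorem CubeLinked.succ (hcube : CubeLinked d) (hd : 4 ≤ d) : CubeLinked (d + 1) := by
  intro X l hX hl
  by_contra h
  obtain ⟨σ, hσ⟩ := hl.exists_isPartner
  have hcard : X.card ≠ d + 2 :=
    (hcube.isObstruction_of_not_linkable hd hσ hX h).card_ne hσ (by omega)
  exact h (hcube.linkable_of_released (R := ∅) (i := 0) hd hσ hX (by simp) (by simp) (by simp)
    fun _ => Or.inl (by omega))

end Induction

section DisjointJoins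

variable {V ι : Type*} {G : SimpleGraph V} {A X X' : Set V} {s t a b u v w : V}

/-- The set `A` spans a connected subgraph of `G` through `u` and `v`; it stands for a path from
`u` to `v` whose exact course is irrelevant. -/
def Joins (G : SimpleGraph V) (A : Set V) (u v : V) : Prop :=
  u ∈ A ∧ v ∈ A ∧ (G.induce A).Preconnected

theorem Joins.symm (h : Joins G A u v) : Joins G A v u := ⟨h.2.1, h.1, h.2.2⟩

theorem joins_singleton (u : V) : Joins G {u} u u := ⟨rfl, rfl, .of_subsingleton⟩

theorem Joins.insert (h : Joins G A u v) (hwu : G.Adj w u) : Joins G (insert w A) w v := by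
  refine ⟨Set.mem_insert w A, Set.mem_insert_of_mem w h.2.1,
    preconnected_induce_of_forall_adj h.2.2 (Set.subset_insert w A) fun x hx hxA => ?_⟩
  obtain rfl := hx.resolve_right hxA
  exact ⟨u, h.1, hwu⟩

/-- Disjoint connections inside `X` from `s` to `t` and from `a` to `b`. -/
def DisjointlyJoined (G : SimpleGraph V) (X : Set V) (s t a b : V) : Prop :=
  ∃ A B : Set V, A ⊆ X ∧ B ⊆ X ∧ Disjoint A B ∧ Joins G A s t ∧ Joins G B a b

theorem DisjointlyJoined.swap (h : DisjointlyJoined G X s t a b) :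
    DisjointlyJoined G X a b s t := by
  obtain ⟨A, B, hA, hB, hAB, hst, hab⟩ := h
  exact ⟨B, A, hB, hA, hAB.symm, hab, hst⟩

theorem DisjointlyJoined.symm_left (h : DisjointlyJoined G X s t a b) :
    DisjointlyJoined G X t s a b := by
  obtain ⟨A, B, hA, hB, hAB, hst, hab⟩ := h
  exact ⟨A, B, hA, hB, hAB, hst.symm, hab⟩

theorem DisjointlyJoined.symm_right (h : DisjointlyJoined G X s t a b) :
    DisjointlyJoined G X s t b a :=
  h.swap.symm_left.swap

theorem IsPartner.linkable_of_reachable {Y : Finset V} {l : V → ι} {σ : V → V}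
    (hσ : IsPartner Y l σ) {c : V → ι}
    (hc : ∀ y ∈ Y, c y = l y ∧ (monochromaticOn G c X).Reachable y (σ y)) :
    Linkable G X Y l := by
  refine ⟨c, fun y hy => (hc y hy).1, fun x hx y hy hxy => ?_⟩
  rcases hσ.eq_or x hx y hy hxy with rfl | rfl
  exacts [.refl _, (hc x hx).2]

theorem Joins.linkable {Y : Finset V} {l : V → ι} {σ : V → V} (hσ : IsPartner Y l σ)
    (hs : s ∈ Y) (h : Joins G A s (σ s))
    (hA : ∀ y ∈ Y, y ≠ s → y ≠ σ s → σ y = y ∧ y ∉ A) :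
    Linkable G Set.univ Y l := by
  classical
  let c : V → ι := fun v => if v ∈ A then l s else l v
  have hcA : ∀ v ∈ A, c v = l s := fun v hv => if_pos hv
  have join := reachable_of_induce_preconnected h.2.2 hcA h.1 h.2.1
  refine hσ.linkable_of_reachable (c := c) fun y hy => ?_
  by_cases hys : y = s
  · exact hys ▸ ⟨hcA s h.1, join⟩
  by_cases hyt : y = σ s
  · rw [hyt, hσ.invol s hs, hσ.label s hs]
    exact ⟨hcA _ h.2.1, join.symm⟩
  obtain ⟨hfix, hyA⟩ := hA y hy hys hyt
  exact ⟨if_neg hyA, by rw [hfix]⟩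

theorem DisjointlyJoined.linkable {Y : Finset V} {l : V → ι} {σ : V → V}
    (hσ : IsPartner Y l σ) (hs : s ∈ Y) (ha : a ∈ Y)
    (h : DisjointlyJoined G X s (σ s) a (σ a))
    (hX : ∀ y ∈ Y, y ≠ s → y ≠ σ s → y ≠ a → y ≠ σ a → σ y = y ∧ y ∉ X) :
    Linkable G Set.univ Y l := by
  classical
  obtain ⟨A, B, hA, hB, hAB, hst, hab⟩ := h
  let c : V → ι := fun v => if v ∈ A then l s else if v ∈ B then l a else l v
  have hcA : ∀ v ∈ A, c v = l s := fun v hv => if_pos hv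
  have hcB : ∀ v ∈ B, c v = l a := fun v hv =>
    (if_neg (hAB.notMem_of_mem_right hv)).trans (if_pos hv)
  have hcX : ∀ v ∉ X, c v = l v := fun v hv =>
    (if_neg fun h => hv (hA h)).trans (if_neg fun h => hv (hB h))
  have joinA := reachable_of_induce_preconnected hst.2.2 hcA hst.1 hst.2.1
  have joinB := reachable_of_induce_preconnected hab.2.2 hcB hab.1 hab.2.1
  refine hσ.linkable_of_reachable (c := c) fun y hy => ?_
  by_cases hys : y = s
  · exact hys ▸ ⟨hcA s hst.1, joinA⟩
  by_cases hyt : y = σ s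
  · rw [hyt, hσ.invol s hs, hσ.label s hs]
    exact ⟨hcA _ hst.2.1, joinA.symm⟩
  by_cases hya : y = a
  · exact hya ▸ ⟨hcB a hab.1, joinB⟩
  by_cases hyb : y = σ a
  · rw [hyb, hσ.invol a ha, hσ.label a ha]
    exact ⟨hcB _ hab.2.1, joinB.symm⟩
  obtain ⟨hfix, hyX⟩ := hX y hy hys hyt hya hyb
  exact ⟨hcX y hyX, by rw [hfix]⟩

end DisjointJoins

section TwoPairs

variable {d : ℕ} {s t a b x : Fin (d + 1) → Bool}

theorem joins_facet_diff {i : Fin (d + 1)} {Z : Finset (Fin (d + 1) → Bool)}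
    (hZ : Z.card ≤ d - 1) (hst : t i = s i) (hs : s ∉ Z) (ht : t ∉ Z) :
    Joins (cubeGraph (d + 1)) {y | y i = s i ∧ y ∉ Z} s t :=
  ⟨⟨rfl, hs⟩, ⟨hst, ht⟩, facet_diff_preconnected i _ ((Finset.card_filter_le _ _).trans hZ)⟩

theorem disjointlyJoined_of_separated_pairs {i : Fin (d + 1)} (hd : 2 ≤ d) (hst : t i = s i)
    (hab : b i = a i) (hsa : s i ≠ a i) (hxs : x ≠ s) (hxt : x ≠ t) (hxa : x ≠ a) (hxb : x ≠ b) :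
    DisjointlyJoined (cubeGraph (d + 1)) {x}ᶜ s t a b := by
  have hcard : ({x} : Finset (Fin (d + 1) → Bool)).card ≤ d - 1 := by
    rw [Finset.card_singleton]; omega
  refine ⟨_, _, fun y hy => ?_, fun y hy => ?_, Set.disjoint_left.2 fun y hy hy' => ?_,
    joins_facet_diff hcard hst ?_ ?_, joins_facet_diff hcard hab ?_ ?_⟩
  · simpa using hy.2
  · simpa using hy.2
  · exact hsa (hy.1.symm.trans hy'.1)
  all_goals rw [Finset.mem_singleton]
  exacts [hxs.symm, hxt.symm, hxa.symm, hxb.symm]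

theorem exists_flipAt_notMem (a : Fin (d + 1) → Bool) (i : Fin (d + 1))
    {Z : Finset (Fin (d + 1) → Bool)} (hZ : Z.card < d) : ∃ j ≠ i, flipAt a j ∉ Z := by
  have hinj : Function.Injective (flipAt a) := fun j k hjk => by
    by_contra hne
    have hj := congrFun hjk j
    rw [flipAt_of_ne a hne] at hj
    exact flipAt_apply_ne a j hj
  have hcard : Z.card < ((Finset.univ.erase i).image (flipAt a)).card := by
    simpa [Finset.card_image_of_injective _ hinj] using hZ
  obtain ⟨_, hv, hvZ⟩ := Finset.exists_mem_notMem_of_card_lt_card hcard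
  obtain ⟨j, hj, rfl⟩ := Finset.mem_image.1 hv
  exact ⟨j, Finset.ne_of_mem_erase hj, hvZ⟩

theorem disjointlyJoined_of_separated_right_of_apply_eq {i : Fin (d + 1)} (hd : 3 ≤ d)
    (hst : t i = s i) (has : a i = s i) (hbs : b i ≠ s i) (hsa : s ≠ a) (hta : t ≠ a)
    (hxs : x ≠ s) (hxt : x ≠ t) (hxa : x ≠ a) (hxb : x ≠ b) :
    DisjointlyJoined (cubeGraph (d + 1)) {x}ᶜ s t a b := by
  have hflip : ∀ {y : Fin (d + 1) → Bool}, y i = s i → b i = flipAt y i i := fun hy => by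
    rw [flipAt_same, hy, Bool.eq_not_iff.2 hbs]
  have hpair : ∀ y z : Fin (d + 1) → Bool, ({y, z} : Finset _).card ≤ d - 1 := fun y z =>
    Finset.card_le_two.trans (by omega)
  have hsingle : ({x} : Finset (Fin (d + 1) → Bool)).card ≤ d - 1 := by
    rw [Finset.card_singleton]; omega
  by_cases hxflip : x = flipAt a i
  · obtain ⟨j, hji, hj⟩ := exists_flipAt_notMem a i (Z := {s, t})
      (Finset.card_le_two.trans_lt hd)
    simp only [Finset.mem_insert, Finset.mem_singleton, not_or] at hj
    have hji' : flipAt a j i = s i := (flipAt_of_ne a hji.symm).trans has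
    have hxi : x i ≠ s i := by rw [hxflip, flipAt_same, has]; simp
    have hA := joins_facet_diff (hpair a (flipAt a j)) hst (by simp [hsa, Ne.symm hj.1])
      (by simp [hta, Ne.symm hj.2])
    have hB := (((joins_facet_diff hsingle (hflip hji')
      (by simpa [hxflip] using fun h => flipAt_ne a j (flipAt_left_injective i h))
      (by simpa using hxb.symm)).insert (cubeGraph_adj_flipAt _ i)).insert
      (cubeGraph_adj_flipAt a j))
    refine ⟨_, _, ?_, ?_, Set.disjoint_left.2 ?_, hA, hB⟩
    · rintro y hy rfl
      exact hxi hy.1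
    · rintro y (rfl | rfl | hy) rfl
      exacts [hxa rfl, hxi hji', by simp at hy]
    · rintro y hy (rfl | rfl | hy')
      exacts [hy.2 (by simp), hy.2 (by simp), hbs ((hflip hji').trans (hy'.1.symm.trans hy.1))]
  · have hA := joins_facet_diff (hpair a x) hst (by simp [hsa, hxs.symm]) (by simp [hta, hxt.symm])
    have hB := (joins_facet_diff hsingle (hflip has) (by simpa using Ne.symm hxflip)
      (by simpa using hxb.symm)).insert (cubeGraph_adj_flipAt a i)
    refine ⟨_, _, ?_, ?_, Set.disjoint_left.2 ?_, hA, hB⟩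
    · rintro y hy rfl
      exact hy.2 (by simp)
    · rintro y (rfl | hy) rfl
      exacts [hxa rfl, by simp at hy]
    · rintro y hy (rfl | hy')
      exacts [hy.2 (by simp), hbs ((hflip has).trans (hy'.1.symm.trans hy.1))]

theorem disjointlyJoined_of_separated_right {i : Fin (d + 1)} (hd : 3 ≤ d) (hst : t i = s i)
    (hab : b i ≠ a i) (hsa : s ≠ a) (hsb : s ≠ b) (hta : t ≠ a) (htb : t ≠ b)
    (hxs : x ≠ s) (hxt : x ≠ t) (hxa : x ≠ a) (hxb : x ≠ b) :
    DisjointlyJoined (cubeGraph (d + 1)) {x}ᶜ s t a b := by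
  by_cases has : a i = s i
  · exact disjointlyJoined_of_separated_right_of_apply_eq hd hst has (has ▸ hab) hsa hta hxs hxt
      hxa hxb
  · have hbs : b i = s i := (Bool.eq_not_iff.2 hab).trans (Bool.eq_not_iff.2 (Ne.symm has)).symm
    exact (disjointlyJoined_of_separated_right_of_apply_eq hd hst hbs has hsb htb hxs hxt
      hxb hxa).symm_right

theorem DisjointlyJoined.of_joins_facet {i : Fin (d + 1)} {B : Set (Fin (d + 1) → Bool)}
    (hd : 2 ≤ d) (hB : Joins (cubeGraph (d + 1)) B a b) (hBi : ∀ y ∈ B, y i = s i)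
    (hxB : x ∉ B) (hsB : s ∉ B) (htB : t ∉ B) (hst : t i = s i) (hxs : x ≠ s) (hxt : x ≠ t)
    (hxs' : x ≠ flipAt s i) (hxt' : x ≠ flipAt t i) :
    DisjointlyJoined (cubeGraph (d + 1)) {x}ᶜ s t a b := by
  have hcard : ({x} : Finset (Fin (d + 1) → Bool)).card ≤ d - 1 := by
    rw [Finset.card_singleton]; omega
  have hopp := joins_facet_diff (i := i) (s := flipAt s i) (t := flipAt t i) hcard
    (by simp [hst]) (by simpa using hxs'.symm) (by simpa using hxt'.symm)
  have hA := ((hopp.insert (cubeGraph_adj_flipAt s i)).symm.insert (cubeGraph_adj_flipAt t i)).symm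
  refine ⟨_, B, ?_, fun y hy => ?_, Set.disjoint_left.2 ?_, hA, hB⟩
  · rintro y (rfl | rfl | hy)
    exacts [hxt.symm, hxs.symm, by simpa using hy.2]
  · rintro rfl
    exact hxB hy
  · rintro y (rfl | rfl | hy) hyB
    exacts [htB hyB, hsB hyB, flipAt_apply_ne s i (hy.1.symm.trans (hBi y hyB))]

theorem disjointlyJoined_of_opposite {i : Fin (d + 1)} (hd : 3 ≤ d) (hst : t i = s i)
    (has : a i = s i) (hbs : b i = s i) (hxi : x i ≠ s i) (hsa : s ≠ a) (hsb : s ≠ b)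
    (hta : t ≠ a) (htb : t ≠ b) (hxs : x ≠ s) (hxt : x ≠ t) (hxa : x ≠ a) (hxb : x ≠ b) :
    DisjointlyJoined (cubeGraph (d + 1)) {x}ᶜ s t a b := by
  wlog hx : x ≠ flipAt s i ∧ x ≠ flipAt t i generalizing s t a b
  · have hflip : ∀ {y z : Fin (d + 1) → Bool}, y ≠ z → x = flipAt y i → x ≠ flipAt z i :=
      fun hyz hy hz => hyz (flipAt_left_injective i (hy.symm.trans hz))
    refine (this (hbs.trans has.symm) has.symm (hst.trans has.symm) (has ▸ hxi) hsa.symm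
      hta.symm hsb.symm htb.symm hxa hxb hxs hxt ?_).swap
    rcases not_and_or.1 hx with hx | hx
    · exact ⟨hflip hsa (not_not.1 hx), hflip hsb (not_not.1 hx)⟩
    · exact ⟨hflip hta (not_not.1 hx), hflip htb (not_not.1 hx)⟩
  exact .of_joins_facet (i := i) (by omega)
    (joins_facet_diff (Z := {s, t}) (Finset.card_le_two.trans (by omega)) (hbs.trans has.symm)
      (by simp [hsa.symm, hta.symm]) (by simp [hsb.symm, htb.symm]))
    (fun _ hy => hy.1.trans has) (fun hx => hxi (hx.1.trans has)) (fun hs => hs.2 (by simp))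
    (fun ht => ht.2 (by simp)) hst hxs hxt hx.1 hx.2

end TwoPairs

section FourCube

variable {s t a b x : Fin 4 → Bool}

theorem disjointlyJoined_of_flipAt {d : ℕ} {m i j k : Fin d} (hi : i ≠ m) (hj : j ≠ m)
    (hk : k ≠ m) (hij : i ≠ j) (hik : i ≠ k) (hjk : j ≠ k) (s : Fin d → Bool) :
    DisjointlyJoined (cubeGraph d) {y | y m = s m} s (flipAt (flipAt (flipAt s i) j) k)
      (flipAt (flipAt s i) k) (flipAt s j) := by
  have hpath : ∀ u : Fin d → Bool, Joins (cubeGraph d)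
      {u, flipAt u i, flipAt (flipAt u i) j, flipAt (flipAt (flipAt u i) j) k} u
      (flipAt (flipAt (flipAt u i) j) k) := fun u =>
    (((joins_singleton _).insert (cubeGraph_adj_flipAt _ k)).insert
      (cubeGraph_adj_flipAt _ j)).insert (cubeGraph_adj_flipAt u i)
  have hend : flipAt (flipAt (flipAt (flipAt (flipAt s i) k) i) j) k = flipAt s j := by
    ext n
    by_cases hni : n = i <;> by_cases hnj : n = j <;> by_cases hnk : n = k <;>
      simp_all [flipAt, Function.update_apply]
  refine ⟨_, _, ?_, ?_, Set.disjoint_left.2 ?_, hpath s, hend ▸ hpath (flipAt (flipAt s i) k)⟩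
  · rintro y (rfl | rfl | rfl | rfl) <;> simp [flipAt_of_ne, hi.symm, hj.symm, hk.symm]
  · rintro y (rfl | rfl | rfl | rfl) <;> simp [flipAt_of_ne, hi.symm, hj.symm, hk.symm]
  · intro y hy hy'
    have hchain : (y i = s i → y j = s j) ∧ (y j = s j → y k = s k) := by
      rcases hy with rfl | rfl | rfl | rfl <;>
        simp [flipAt_of_ne, hij, hij.symm, hik, hik.symm, hjk, hjk.symm]
    rcases hy' with rfl | rfl | rfl | rfl <;>
      simp [flipAt_of_ne, hij, hij.symm, hik, hik.symm, hjk, hjk.symm] at hchain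

theorem exists_other_directions : ∀ {m q : Fin 4}, q ≠ m →
    ∃ p r, p ≠ m ∧ p ≠ q ∧ r ≠ m ∧ r ≠ q ∧ r ≠ p ∧ ∀ n, n = m ∨ n = q ∨ n = p ∨ n = r := by
  decide

theorem disjointlyJoined_of_antipodal_flipAt {m q : Fin 4} (hqm : q ≠ m) (htm : t m = s m)
    (hbm : b m = s m) (hst : ∀ n ≠ m, t n ≠ s n) (hab : ∀ n ≠ m, b n ≠ flipAt s q n) :
    DisjointlyJoined (cubeGraph 4) {y | y m = s m} s t (flipAt s q) b := by
  obtain ⟨p, r, hpm, hpq, hrm, hrq, hrp, hall⟩ := exists_other_directions hqm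
  have hext : ∀ {y z : Fin 4 → Bool}, y m = z m → y q = z q → y p = z p → y r = z r → y = z :=
    fun hm hq hp hr => funext fun n => by rcases hall n with rfl | rfl | rfl | rfl <;> assumption
  have ht : t = flipAt (flipAt (flipAt s p) q) r := hext
    (by simp [flipAt_of_ne, hpm.symm, hqm.symm, hrm.symm, htm])
    (by simp [flipAt_of_ne, hpq.symm, hrq.symm, Bool.eq_not_iff.2 (hst q hqm)])
    (by simp [flipAt_of_ne, hpq, hrp.symm, Bool.eq_not_iff.2 (hst p hpm)])
    (by simp [flipAt_of_ne, hrp, hrq, Bool.eq_not_iff.2 (hst r hrm)])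
  have hb : b = flipAt (flipAt s p) r := hext
    (by simp [flipAt_of_ne, hpm.symm, hrm.symm, hbm])
    (by simp [flipAt_of_ne, hpq.symm, hrq.symm, Bool.eq_not_iff.2 (hab q hqm)])
    (by simp [flipAt_of_ne, hpq, hrp.symm, Bool.eq_not_iff.2 (hab p hpm)])
    (by simp [flipAt_of_ne, hrp, hrq, Bool.eq_not_iff.2 (hab r hrm)])
  rw [ht, hb]
  exact (disjointlyJoined_of_flipAt hpm hqm hrm hpq hrp.symm hrq.symm s).symm_right

theorem exists_eq_flipAt_of_antipodal {m : Fin 4} (htm : t m = s m) (ham : a m = s m)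
    (hbm : b m = s m) (hst : ∀ n ≠ m, t n ≠ s n) (hab : ∀ n ≠ m, b n ≠ a n) (hsa : s ≠ a)
    (hta : t ≠ a) : ∃ q ≠ m, a = flipAt s q ∨ b = flipAt s q := by
  obtain ⟨q, hq⟩ := Function.ne_iff.1 hsa.symm
  have hqm : q ≠ m := by
    rintro rfl
    exact hq ham
  obtain ⟨p, r, hpm, hpq, hrm, hrq, hrp, hall⟩ := exists_other_directions hqm
  have hforall : ∀ {P : Fin 4 → Prop}, P m → P q → P p → P r → ∀ n, P n := fun hm hq hp hr n => by
    rcases hall n with rfl | rfl | rfl | rfl <;> assumption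
  have hbs : ∀ n ≠ m, (b n = s n ↔ a n ≠ s n) := fun n hn => by
    rw [Bool.eq_not_iff.2 (hab n hn), Bool.not_eq_eq_eq_not, ← Bool.eq_not_iff]
  by_cases hp : a p = s p <;> by_cases hr : a r = s r
  · exact ⟨q, hqm, .inl <| eq_flipAt_of_forall hq <| hforall (fun _ => ham) (absurd rfl)
      (fun _ => hp) (fun _ => hr)⟩
  · exact ⟨p, hpm, .inr <| eq_flipAt_of_forall (fun h => (hbs p hpm).1 h hp) <|
      hforall (fun _ => hbm) (fun _ => (hbs q hqm).2 hq) (absurd rfl) (fun _ => (hbs r hrm).2 hr)⟩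
  · exact ⟨r, hrm, .inr <| eq_flipAt_of_forall (fun h => (hbs r hrm).1 h hr) <|
      hforall (fun _ => hbm) (fun _ => (hbs q hqm).2 hq) (fun _ => (hbs p hpm).2 hp) (absurd rfl)⟩
  · have hat : ∀ n ≠ m, a n ≠ s n → t n = a n := fun n hn hne =>
      (Bool.eq_not_iff.2 (hst n hn)).trans (Bool.eq_not_iff.2 hne).symm
    exact absurd (funext <| hforall (htm.trans ham.symm) (hat q hqm hq) (hat p hpm hp)
      (hat r hrm hr)) hta

theorem disjointlyJoined_of_antipodal {m : Fin 4} (htm : t m = s m) (ham : a m = s m)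
    (hbm : b m = s m) (hst : ∀ n ≠ m, t n ≠ s n) (hab : ∀ n ≠ m, b n ≠ a n) (hsa : s ≠ a)
    (hta : t ≠ a) : DisjointlyJoined (cubeGraph 4) {y | y m = s m} s t a b := by
  obtain ⟨q, hqm, rfl | rfl⟩ := exists_eq_flipAt_of_antipodal htm ham hbm hst hab hsa hta
  · exact disjointlyJoined_of_antipodal_flipAt hqm htm hbm hst hab
  · exact (disjointlyJoined_of_antipodal_flipAt hqm htm ham hst fun n hn =>
      (hab n hn).symm).symm_right

theorem exists_forall_separated
    (h : ∀ i, (t i = s i ∧ a i = s i ∧ b i = s i ∧ x i = s i) ∨ (t i ≠ s i ∧ b i ≠ a i))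
    (hsa : s ≠ a) (hta : t ≠ a) (hxs : x ≠ s) (hxt : x ≠ t) (hxa : x ≠ a) (hxb : x ≠ b) :
    ∃ m, ∀ n ≠ m, t n ≠ s n ∧ b n ≠ a n := by
  by_contra! hagree
  have hagree' : ∀ m, ∃ n ≠ m, t n = s n ∧ a n = s n ∧ b n = s n ∧ x n = s n := fun m => by
    obtain ⟨n, hn, hsep⟩ := hagree m
    exact ⟨n, hn, (h n).resolve_right fun hsep' => hsep'.2 (hsep hsep'.1)⟩
  obtain ⟨m, -, hm⟩ := hagree' 0
  obtain ⟨n, hnm, hn⟩ := hagree' m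
  obtain ⟨i, hi⟩ := Function.ne_iff.1 hta
  obtain ⟨j, hj⟩ := Function.ne_iff.1 hsa
  have hsep : ∀ k, k = i ∨ k = j → t k = !s k ∧ b k = !a k := fun k hk =>
    ((h k).resolve_left fun hk' => by
      rcases hk with rfl | rfl
      exacts [hi (hk'.1.trans hk'.2.1.symm), hj hk'.2.1.symm]).imp
        Bool.eq_not_iff.2 Bool.eq_not_iff.2
  obtain ⟨hti, hbi⟩ := hsep i (.inl rfl)
  obtain ⟨htj, hbj⟩ := hsep j (.inr rfl)
  have hai : a i = s i := by simpa [hti, eq_comm] using hi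
  have haj : a j = !s j := Bool.eq_not_iff.2 (Ne.symm hj)
  have hall : ∀ k, k = m ∨ k = n ∨ k = i ∨ k = j := by
    have hij : i ≠ j := by
      rintro rfl
      exact hj hai.symm
    have hne : ∀ k, t k = s k → i ≠ k ∧ j ≠ k := fun k hk => by
      constructor <;> rintro rfl <;> simp_all
    have := hne m hm.1
    have := hne n hn.1
    omega
  have hx : ∀ y : Fin 4 → Bool, x ≠ y → y m = s m → y n = s n → y i = x i → y j ≠ x j :=
    fun y hxy hym hyn hyi hyj => hxy <| funext fun k => by
      rcases hall k with rfl | rfl | rfl | rfl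
      exacts [hm.2.2.2.trans hym.symm, hn.2.2.2.trans hyn.symm, hyi.symm, hyj.symm]
  have hxi : x i = s i ∨ x i = !s i := by cases x i <;> cases s i <;> simp
  rcases hxi with hxi | hxi
  · have := hx s hxs rfl rfl hxi.symm
    have := hx a hxa hm.2.1 hn.2.1 (hai.trans hxi.symm)
    simp_all
  · have := hx t hxt hm.1 hn.1 (hti.trans hxi.symm)
    have := hx b hxb hm.2.2.1 hn.2.2.1 (by simp_all)
    simp_all

theorem disjointlyJoined_of_forall_ne_of_apply_eq (hst : ∀ n, t n ≠ s n) (hab : ∀ n, b n ≠ a n)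
    (hsa : s ≠ a) {i j : Fin 4} (hij : i ≠ j) (hi : a i = s i) (hj : a j = s j) (hxi : x i = s i)
    (hxs : x ≠ s) (hxa : x ≠ a) : DisjointlyJoined (cubeGraph 4) {x}ᶜ s t a b := by
  have hflip : ∀ (y : Fin 4 → Bool) {n}, n ≠ i → flipAt y i n = y n := fun y _ hn =>
    flipAt_of_ne y hn
  obtain ⟨A, B, hA, hB, hAB, hstA, habB⟩ := disjointlyJoined_of_antipodal (m := i)
    (s := flipAt s i) (t := t) (a := flipAt a i) (b := b)
    (by rw [flipAt_same, Bool.eq_not_iff.2 (hst i)]) (by rw [flipAt_same, flipAt_same, hi])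
    (by rw [flipAt_same, ← hi, Bool.eq_not_iff.2 (hab i)])
    (fun n hn => by rw [hflip s hn]; exact hst n) (fun n hn => by rw [hflip a hn]; exact hab n)
    ((flipAt_left_injective i).ne hsa)
    (fun h => hst j (by rw [h, hflip a hij.symm, hj]))
  have hnot : ∀ {C : Set (Fin 4 → Bool)} {y : Fin 4 → Bool}, C ⊆ {z | z i = flipAt s i i} →
      y i = s i → y ∉ C := fun hC hy hyC =>
    flipAt_apply_ne s i ((hC hyC).symm.trans hy)
  refine ⟨_, _, ?_, ?_, Set.disjoint_left.2 ?_, hstA.insert (cubeGraph_adj_flipAt s i),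
    habB.insert (cubeGraph_adj_flipAt a i)⟩
  · rintro y (rfl | hy) rfl
    exacts [hxs rfl, hnot hA hxi hy]
  · rintro y (rfl | hy) rfl
    exacts [hxa rfl, hnot hB hxi hy]
  · rintro y (rfl | hy) (hya | hy')
    exacts [hsa hya, hnot hB rfl hy', hnot hA (hya ▸ hi) hy, hAB.notMem_of_mem_left hy hy']

theorem disjointlyJoined_of_forall_ne (hst : ∀ n, t n ≠ s n) (hab : ∀ n, b n ≠ a n)
    (hsa : s ≠ a) (hsb : s ≠ b) (hta : t ≠ a) (htb : t ≠ b)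
    (hxs : x ≠ s) (hxt : x ≠ t) (hxa : x ≠ a) (hxb : x ≠ b) :
    DisjointlyJoined (cubeGraph 4) {x}ᶜ s t a b := by
  wlog hagree : ∃ i j, i ≠ j ∧ a i = s i ∧ a j = s j generalizing a b
  · obtain ⟨i, j, hij, hagree'⟩ := Fintype.exists_ne_map_eq_of_card_lt
      (fun n => a n == s n) (by simp)
    refine (this (fun n => (hab n).symm) hsb hsa htb hta hxb hxa ⟨i, j, hij, ?_⟩).symm_right
    have hai : a i ≠ s i := fun h => hagree ⟨i, j, hij, h, by simp_all⟩
    have haj : a j ≠ s j := fun h => hagree ⟨i, j, hij, by simp_all, h⟩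
    exact ⟨(Bool.eq_not_iff.2 (hab i)).trans (Bool.eq_not_iff.2 hai.symm).symm,
      (Bool.eq_not_iff.2 (hab j)).trans (Bool.eq_not_iff.2 haj.symm).symm⟩
  obtain ⟨i, j, hij, hi, hj⟩ := hagree
  by_cases hxi : x i = s i
  · exact disjointlyJoined_of_forall_ne_of_apply_eq hst hab hsa hij hi hj hxi hxs hxa
  · have hopp : ∀ {n}, a n = s n → b n = t n := fun {n} hn => by
      rw [Bool.eq_not_iff.2 (hab n), Bool.eq_not_iff.2 (hst n), hn]
    exact (disjointlyJoined_of_forall_ne_of_apply_eq (fun n => (hst n).symm)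
      (fun n => (hab n).symm) htb hij (hopp hi) (hopp hj)
      ((Bool.eq_not_iff.2 hxi).trans (Bool.eq_not_iff.2 (hst i)).symm)
      hxt hxb).symm_left.symm_right

theorem disjointlyJoined_of_unanimous {m : Fin 4} (htm : t m = s m) (ham : a m = s m)
    (hbm : b m = s m) (hxm : x m = s m) (hst : ∀ n ≠ m, t n ≠ s n) (hab : ∀ n ≠ m, b n ≠ a n)
    (hsa : s ≠ a) (hta : t ≠ a) (hxs : x ≠ s) (hxt : x ≠ t) (hxa : x ≠ a) (hxb : x ≠ b) :
    DisjointlyJoined (cubeGraph 4) {x}ᶜ s t a b := by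
  obtain ⟨A, B, hA, hB, hAB, hstA, habB⟩ :=
    disjointlyJoined_of_antipodal htm ham hbm hst hab hsa hta
  have hflip : ∀ y : Fin 4 → Bool, y m = s m → x ≠ flipAt y m := by
    rintro y hy rfl
    exact flipAt_apply_ne y m (hxm.trans hy.symm)
  by_cases hxB : x ∈ B
  · exact (DisjointlyJoined.of_joins_facet (i := m) (by simp) hstA
      (fun y hy => (hA hy).trans ham.symm)
      (hAB.notMem_of_mem_right hxB) (hAB.notMem_of_mem_right habB.1)
      (hAB.notMem_of_mem_right habB.2.1) (hbm.trans ham.symm) hxa hxb (hflip a ham)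
      (hflip b hbm)).swap
  · exact .of_joins_facet (i := m) (by simp) habB hB hxB (hAB.notMem_of_mem_left hstA.1)
      (hAB.notMem_of_mem_left hstA.2.1) htm hxs hxt (hflip s rfl) (hflip t htm)

theorem disjointlyJoined_compl_singleton (hsa : s ≠ a) (hsb : s ≠ b) (hta : t ≠ a) (htb : t ≠ b)
    (hxs : x ≠ s) (hxt : x ≠ t) (hxa : x ≠ a) (hxb : x ≠ b) :
    DisjointlyJoined (cubeGraph 4) {x}ᶜ s t a b := by
  by_contra hnot
  have h : ∀ i, (t i = s i ∧ a i = s i ∧ b i = s i ∧ x i = s i) ∨ (t i ≠ s i ∧ b i ≠ a i) := by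
    intro i
    by_cases hsti : t i = s i <;> by_cases habi : b i = a i
    · refine .inl ⟨hsti, ?_⟩
      by_cases hai : a i = s i
      · refine ⟨hai, habi.trans hai, ?_⟩
        by_contra hxi
        exact hnot (disjointlyJoined_of_opposite (by simp) hsti hai (habi.trans hai) hxi hsa hsb
          hta htb hxs hxt hxa hxb)
      · exact absurd (disjointlyJoined_of_separated_pairs (by simp) hsti habi (Ne.symm hai) hxs hxt
          hxa hxb) hnot
    · exact absurd (disjointlyJoined_of_separated_right (by simp) hsti habi hsa hsb hta htb hxs hxt
        hxa hxb) hnot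
    · exact absurd (disjointlyJoined_of_separated_right (by simp) habi hsti hsa.symm hta.symm
        hsb.symm htb.symm hxa hxb hxs hxt).swap hnot
    · exact .inr ⟨hsti, habi⟩
  obtain ⟨m, hm⟩ := exists_forall_separated h hsa hta hxs hxt hxa hxb
  rcases h m with ⟨htm, ham, hbm, hxm⟩ | hm'
  · exact hnot (disjointlyJoined_of_unanimous htm ham hbm hxm (fun n hn => (hm n hn).1)
      (fun n hn => (hm n hn).2) hsa hta hxs hxt hxa hxb)
  · have hall : ∀ n, t n ≠ s n ∧ b n ≠ a n := fun n => by
      by_cases hn : n = m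
      exacts [hn ▸ hm', hm n hn]
    exact hnot (disjointlyJoined_of_forall_ne (fun n => (hall n).1) (fun n => (hall n).2)
      hsa hsb hta htb hxs hxt hxa hxb)

end FourCube

section SmallCubes

variable {d : ℕ} {Y : Finset (Fin d → Bool)} {l : (Fin d → Bool) → ℕ}
  {σ : (Fin d → Bool) → (Fin d → Bool)} {s a : Fin d → Bool}

theorem IsPartner.linkable_of_one_pair (hσ : IsPartner Y l σ) (hY : Y.card ≤ d + 1) (hs : s ∈ Y)
    (hss : σ s ≠ s) (hfix : ∀ y ∈ Y, y ≠ s → y ≠ σ s → σ y = y) :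
    Linkable (cubeGraph d) Set.univ Y l := by
  have hcard : (Y \ {s, σ s}).card ≤ d - 1 := by
    rw [Finset.card_sdiff_of_subset (by simp [Finset.insert_subset_iff, hs, hσ.mem s hs]),
      Finset.card_pair hss.symm]
    omega
  refine Joins.linkable hσ hs
    ⟨by simp, by simp, cubeGraph_induce_compl_preconnected d _ hcard⟩ fun y hy hys hyt => ?_
  exact ⟨hfix y hy hys hyt, by simp [hy, hys, hyt]⟩

theorem cubeLinked_of_two_pairs
    (h : ∀ (Y : Finset (Fin d → Bool)) (l : (Fin d → Bool) → ℕ)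
      (σ : (Fin d → Bool) → Fin d → Bool), Y.card ≤ d + 1 → IsPartner Y l σ →
      ∀ s ∈ Y, ∀ a ∈ Y, σ s ≠ s → σ a ≠ a → a ≠ s → a ≠ σ s → Linkable (cubeGraph d) Set.univ Y l) :
    CubeLinked d := by
  intro Y l hY hl
  obtain ⟨σ, hσ⟩ := hl.exists_isPartner
  by_cases htriv : ∀ y ∈ Y, σ y = y
  · exact hσ.linkable_of_reachable (c := l) fun y hy => ⟨rfl, by rw [htriv y hy]⟩
  push Not at htriv
  obtain ⟨s, hs, hss⟩ := htriv
  by_cases hone : ∀ y ∈ Y, y ≠ s → y ≠ σ s → σ y = y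
  · exact hσ.linkable_of_one_pair hY hs hss hone
  push Not at hone
  obtain ⟨a, ha, has, hat, haa⟩ := hone
  exact h Y l σ hY hσ s hs a ha hss haa has hat

theorem IsPartner.ne_of_ne (hσ : IsPartner Y l σ) (hs : s ∈ Y) (ha : a ∈ Y) (has : a ≠ s)
    (hat : a ≠ σ s) : σ a ≠ s ∧ σ a ≠ σ s := by
  refine ⟨fun h => hat ?_, fun h => has ?_⟩
  · rw [← h, hσ.invol a ha]
  · rw [← hσ.invol a ha, h, hσ.invol s hs]

theorem IsPartner.card_two_pairs (hσ : IsPartner Y l σ) (hs : s ∈ Y) (ha : a ∈ Y) (hss : σ s ≠ s)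
    (haa : σ a ≠ a) (has : a ≠ s) (hat : a ≠ σ s) : ({s, σ s, a, σ a} : Finset _).card = 4 := by
  obtain ⟨hsb, htb⟩ := hσ.ne_of_ne hs ha has hat
  rw [Finset.card_insert_of_notMem (by simp [hss.symm, has.symm, hsb.symm]),
    Finset.card_insert_of_notMem (by simp [hat.symm, htb.symm]), Finset.card_pair haa.symm]

theorem IsPartner.two_pairs_subset (hσ : IsPartner Y l σ) (hs : s ∈ Y) (ha : a ∈ Y) :
    {s, σ s, a, σ a} ⊆ Y := by
  simp [Finset.insert_subset_iff, hs, ha, hσ.mem s hs, hσ.mem a ha]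

theorem cubeLinked_of_le_two (hd : d ≤ 2) : CubeLinked d :=
  cubeLinked_of_two_pairs fun Y l σ hY hσ s hs a ha hss haa has hat => by
    have := Finset.card_le_card (hσ.two_pairs_subset hs ha)
    rw [hσ.card_two_pairs hs ha hss haa has hat] at this
    omega

theorem cubeLinked_four : CubeLinked 4 := by
  refine cubeLinked_of_two_pairs fun Y l σ hY hσ s hs a ha hss haa has hat => ?_
  obtain ⟨hsb, htb⟩ := hσ.ne_of_ne hs ha has hat
  obtain ⟨Y', hYY', hY'⟩ := Finset.exists_superset_card_eq hY (by simp)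
  obtain ⟨x, hx⟩ : ∃ x, Y' \ {s, σ s, a, σ a} = {x} := by
    rw [← Finset.card_eq_one,
      Finset.card_sdiff_of_subset ((hσ.two_pairs_subset hs ha).trans hYY'), hY',
      hσ.card_two_pairs hs ha hss haa has hat]
  have hrest : ∀ y ∈ Y, y ≠ s → y ≠ σ s → y ≠ a → y ≠ σ a → y = x := fun y hy h₁ h₂ h₃ h₄ => by
    rw [← Finset.mem_singleton, ← hx]
    simp [hYY' hy, h₁, h₂, h₃, h₄]
  have hxout : x ∉ ({s, σ s, a, σ a} : Finset _) :=
    (Finset.mem_sdiff.1 (hx ▸ Finset.mem_singleton_self x)).2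
  simp only [Finset.mem_insert, Finset.mem_singleton, not_or] at hxout
  obtain ⟨hxs, hxt, hxa, hxb⟩ := hxout
  refine DisjointlyJoined.linkable hσ hs ha (disjointlyJoined_compl_singleton has.symm hsb.symm
    hat.symm htb.symm hxs hxt hxa hxb) fun y hy h₁ h₂ h₃ h₄ => ?_
  obtain rfl := hrest y hy h₁ h₂ h₃ h₄
  refine ⟨?_, by simp⟩
  by_contra hyy
  obtain ⟨hys, hyt⟩ := hσ.ne_of_ne hs hy h₁ h₂
  obtain ⟨hya, hyb⟩ := hσ.ne_of_ne ha hy h₃ h₄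
  exact hyy (hrest _ (hσ.mem y hy) hys hyt hya hyb)

theorem cubeLinked : ∀ {d : ℕ}, d ≠ 3 → CubeLinked d
  | 0, _ | 1, _ | 2, _ => cubeLinked_of_le_two (by omega)
  | 4, _ => cubeLinked_four
  | d + 5, _ => (cubeLinked (d := d + 4) (by omega)).succ (by omega)

end SmallCubes

section Faces

section ConvexSets

variable {E : Type*} [AddCommGroup E] [Module ℝ E] [TopologicalSpace E] [T2Space E]
  [IsTopologicalAddGroup E] [ContinuousSMul ℝ E] [LocallyConvexSpace ℝ E] {A B : Set E} {v : E}

theorem convexHull_inter_extremePoints_of_isExposed (hA : IsCompact A) (hconv : Convex ℝ A)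
    (hfin : (A.extremePoints ℝ).Finite) (hB : IsExposed ℝ A B) :
    convexHull ℝ (B ∩ A.extremePoints ℝ) = B := by
  rw [← hB.isExtreme.extremePoints_eq]
  have hclosed : IsClosed (convexHull ℝ (B.extremePoints ℝ)) :=
    (hfin.subset hB.isExtreme.extremePoints_subset_extremePoints).isClosed_convexHull ℝ
  rw [← hclosed.closure_eq, closure_convexHull_extremePoints (hB.isCompact hA) (hB.convex hconv)]

theorem isExposed_singleton_of_mem_extremePoints (hA : IsCompact A) (hconv : Convex ℝ A)
    (hfin : (A.extremePoints ℝ).Finite) (hv : v ∈ A.extremePoints ℝ) : IsExposed ℝ A {v} := by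
  have hvC : v ∉ convexHull ℝ (A.extremePoints ℝ \ {v}) := fun h =>
    (convexHull_min (Set.sdiff_subset_sdiff_left extremePoints_subset)
      (hconv.mem_extremePoints_iff_convex_sdiff.1 hv).2 h).2 rfl
  obtain ⟨f, u, hfu, huv⟩ := geometric_hahn_banach_closed_point (convex_convexHull ℝ _)
    ((hfin.subset Set.sdiff_subset).isClosed_convexHull ℝ) hvC
  have hlt : ∀ y ∈ A.extremePoints ℝ, y ≠ v → f y < f v := fun y hy hyv =>
    (hfu y (subset_convexHull ℝ _ ⟨hy, hyv⟩)).trans huv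
  have hmax : ∀ y ∈ A, f y ≤ f v := by
    rw [← convexHull_inter_extremePoints_of_isExposed hA hconv hfin (IsExposed.refl A)]
    refine convexHull_min (t := {y | f y ≤ f v}) (fun y hy => ?_)
      (convex_halfSpace_le f.toLinearMap.isLinear _)
    obtain rfl | hyv := eq_or_ne y v
    exacts [le_refl (f y), (hlt y hy.2 hyv).le]
  have hexp : IsExposed ℝ A (f.toExposed A) := ContinuousLinearMap.toExposed.isExposed
  convert hexp
  have hext : f.toExposed A ∩ A.extremePoints ℝ = {v} := by
    refine Set.eq_singleton_iff_unique_mem.2 ⟨⟨⟨hv.1, hmax⟩, hv⟩, fun y hy => ?_⟩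
    by_contra hyv
    exact (hlt y hy.2 hyv).not_ge (hy.1.2 v hv.1)
  rw [← convexHull_inter_extremePoints_of_isExposed hA hconv hfin hexp, hext, convexHull_singleton]

theorem mem_extremePoints_iff_isExposed_singleton (hA : IsCompact A) (hconv : Convex ℝ A)
    (hfin : (A.extremePoints ℝ).Finite) : v ∈ A.extremePoints ℝ ↔ IsExposed ℝ A {v} :=
  ⟨isExposed_singleton_of_mem_extremePoints hA hconv hfin,
    fun h => isExtreme_singleton.1 h.isExtreme⟩

end ConvexSets

variable {m n : ℕ} {P : Set (EuclideanSpace ℝ (Fin n))} {Q : Set (EuclideanSpace ℝ (Fin m))}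

namespace IsPolytope

theorem isCompact (hP : IsPolytope P) : IsCompact P := by
  obtain ⟨S, hS, rfl⟩ := hP
  exact hS.isCompact_convexHull ℝ

theorem convex (hP : IsPolytope P) : Convex ℝ P := by
  obtain ⟨S, -, rfl⟩ := hP
  exact convex_convexHull ℝ S

theorem finite_extremePoints (hP : IsPolytope P) : (P.extremePoints ℝ).Finite := by
  obtain ⟨S, hS, rfl⟩ := hP
  exact hS.subset extremePoints_convexHull_subset

theorem mem_extremePoints_iff (hP : IsPolytope P) {v : EuclideanSpace ℝ (Fin n)} :
    v ∈ P.extremePoints ℝ ↔ IsExposed ℝ P {v} :=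
  mem_extremePoints_iff_isExposed_singleton hP.isCompact hP.convex hP.finite_extremePoints

theorem eq_convexHull_vertices (hP : IsPolytope P) (F : FaceLattice P) :
    F.1 = convexHull ℝ {v ∈ F.1 | IsExposed ℝ P {v}} := by
  simp only [← hP.mem_extremePoints_iff]
  exact (convexHull_inter_extremePoints_of_isExposed hP.isCompact hP.convex
    hP.finite_extremePoints F.2).symm

theorem polytopeGraph_adj_iff (hP : IsPolytope P) {u v : {v // IsExposed ℝ P {v}}} :
    (polytopeGraph P).Adj u v ↔
      u ≠ v ∧ ∃ F : FaceLattice P, ∀ w : {v // IsExposed ℝ P {v}}, w.1 ∈ F.1 ↔ w = u ∨ w = v := by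
  refine and_congr_right fun _ => ⟨fun h => ⟨⟨_, h⟩, fun w => ⟨fun hw => ?_, ?_⟩⟩, ?_⟩
  · have hends := (mem_extremePoints_iff_forall_segment.1 (hP.mem_extremePoints_iff.2 w.2)).2
      u.1 (u.2.subset rfl) v.1 (v.2.subset rfl) hw
    exact hends.imp (fun h => (Subtype.ext h).symm) fun h => (Subtype.ext h).symm
  · rintro (rfl | rfl)
    exacts [left_mem_segment ℝ _ _, right_mem_segment ℝ _ _]
  · rintro ⟨F, hF⟩
    suffices h : F.1 = segment ℝ u.1 v.1 from h ▸ F.2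
    rw [hP.eq_convexHull_vertices F, ← convexHull_pair]
    congr 1
    ext w
    simp only [Set.mem_sep_iff, Set.mem_insert_iff, Set.mem_singleton_iff]
    constructor
    · rintro ⟨hw, hwP⟩
      exact ((hF ⟨w, hwP⟩).1 hw).imp (congrArg Subtype.val) (congrArg Subtype.val)
    · rintro (rfl | rfl)
      exacts [⟨(hF u).2 (Or.inl rfl), u.2⟩, ⟨(hF v).2 (Or.inr rfl), v.2⟩]

end IsPolytope

instance instOrderBotFaceLattice : OrderBot (FaceLattice P) where
  bot := ⟨∅, isExposed_empty⟩
  bot_le F := Set.empty_subset F.1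

theorem IsPolytope.isAtom_iff (hP : IsPolytope P) {F : FaceLattice P} :
    IsAtom F ↔ ∃ v, F.1 = {v} := by
  constructor
  · intro hF
    have hne : F.1.Nonempty :=
      Set.nonempty_iff_ne_empty.2 fun h => hF.1 (Subtype.ext h)
    obtain ⟨v, hv⟩ := (F.2.isCompact hP.isCompact).extremePoints_nonempty hne
    rw [F.2.isExtreme.extremePoints_eq] at hv
    have hle : (⟨{v}, hP.mem_extremePoints_iff.1 hv.2⟩ : FaceLattice P) ≤ F :=
      Set.singleton_subset_iff.2 hv.1
    have hbot : (⟨{v}, hP.mem_extremePoints_iff.1 hv.2⟩ : FaceLattice P) ≠ ⊥ := fun h =>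
      Set.singleton_ne_empty v (congrArg Subtype.val h)
    exact ⟨v, congrArg Subtype.val ((hF.le_iff_eq hbot).1 hle).symm⟩
  · rintro ⟨v, hv⟩
    refine ⟨fun h => Set.singleton_ne_empty v (hv ▸ congrArg Subtype.val h), fun G hG => ?_⟩
    have hlt : G.1 ⊂ {v} := hv ▸ hG
    exact Subtype.ext (Set.ssubset_singleton_iff.1 hlt)

theorem IsPolytope.exists_vertex_map (hQ : IsPolytope Q) (hP : IsPolytope P)
    (e : FaceLattice P ≃o FaceLattice Q) :
    ∃ ψ : {v // IsExposed ℝ P {v}} → {v // IsExposed ℝ Q {v}},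
      ∀ v, e ⟨{v.1}, v.2⟩ = ⟨{(ψ v).1}, (ψ v).2⟩ := by
  have hatom : ∀ v : {v // IsExposed ℝ P {v}}, ∃ w, (e ⟨{v.1}, v.2⟩).1 = {w} := fun v =>
    hQ.isAtom_iff.1 ((e.isAtom_iff _).2 (hP.isAtom_iff.2 ⟨v.1, rfl⟩))
  choose w hw using hatom
  exact ⟨fun v => ⟨w v, hw v ▸ (e ⟨{v.1}, v.2⟩).2⟩, fun v => Subtype.ext (hw v)⟩

theorem IsPolytope.exists_vertexEquiv (hP : IsPolytope P) (hQ : IsPolytope Q)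
    (e : FaceLattice P ≃o FaceLattice Q) :
    ∃ ψ : {v // IsExposed ℝ P {v}} ≃ {v // IsExposed ℝ Q {v}},
      ∀ v F, (ψ v).1 ∈ (e F).1 ↔ v.1 ∈ F.1 := by
  obtain ⟨f, hf⟩ := hQ.exists_vertex_map hP e
  obtain ⟨g, hg⟩ := hP.exists_vertex_map hQ e.symm
  have hgf : ∀ v, g (f v) = v := fun v => by
    have h := hg (f v)
    rw [← hf, e.symm_apply_apply] at h
    exact Subtype.ext (Set.singleton_injective (congrArg Subtype.val h)).symm
  have hfg : ∀ w, f (g w) = w := fun w => by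
    have h := hf (g w)
    rw [← hg, e.apply_symm_apply] at h
    exact Subtype.ext (Set.singleton_injective (congrArg Subtype.val h)).symm
  refine ⟨⟨f, g, hgf, hfg⟩, fun v F => ?_⟩
  calc (f v).1 ∈ (e F).1 ↔ (⟨{(f v).1}, (f v).2⟩ : FaceLattice Q) ≤ e F :=
        Set.singleton_subset_iff.symm
    _ ↔ (⟨{v.1}, v.2⟩ : FaceLattice P) ≤ F := by rw [← hf, e.le_iff_le]
    _ ↔ v.1 ∈ F.1 := Set.singleton_subset_iff

theorem IsPolytope.nonempty_polytopeGraph_iso (hP : IsPolytope P) (hQ : IsPolytope Q)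
    (e : FaceLattice P ≃o FaceLattice Q) : Nonempty (polytopeGraph P ≃g polytopeGraph Q) := by
  obtain ⟨ψ, hψ⟩ := hP.exists_vertexEquiv hQ e
  refine ⟨⟨ψ, fun {u v} => ?_⟩⟩
  rw [hQ.polytopeGraph_adj_iff, hP.polytopeGraph_adj_iff, e.surjective.exists]
  simp only [ne_eq, ψ.surjective.forall, hψ, EmbeddingLike.apply_eq_iff_eq]

end Faces

section StandardCube

variable {d : ℕ}

/-- The vertex of `[0,1]^d` whose `i`-th coordinate is `1` when `x i` is true and `0` otherwise. -/
noncomputable def cubePoint (x : Fin d → Bool) : EuclideanSpace ℝ (Fin d) :=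
  WithLp.toLp 2 fun i => if x i then 1 else 0

theorem cubePoint_apply (x : Fin d → Bool) (i : Fin d) :
    cubePoint x i = if x i then 1 else 0 := rfl

theorem cubePoint_apply_eq_iff {x y : Fin d → Bool} {i : Fin d} :
    cubePoint x i = cubePoint y i ↔ x i = y i := by
  rw [cubePoint_apply, cubePoint_apply]
  cases x i <;> cases y i <;> simp

theorem cubePoint_injective : Function.Injective (cubePoint (d := d)) := fun _ _ h =>
  funext fun i => cubePoint_apply_eq_iff.1 (congrArg (fun z : EuclideanSpace ℝ (Fin d) => z i) h)

theorem cubePoint_mem_stdCube (x : Fin d → Bool) : cubePoint x ∈ stdCube d := fun i => by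
  rw [cubePoint_apply]
  split_ifs <;> norm_num

theorem image_stdCube :
    EuclideanSpace.equiv (Fin d) ℝ '' stdCube d = Set.univ.pi fun _ => Set.Icc (0 : ℝ) 1 := by
  ext x
  constructor
  · rintro ⟨y, hy, rfl⟩ i -
    exact hy i
  · exact fun hx => ⟨WithLp.toLp 2 x, fun i => hx i trivial, rfl⟩

theorem isCompact_stdCube : IsCompact (stdCube d) := by
  rw [← (EuclideanSpace.equiv (Fin d) ℝ).toHomeomorph.isCompact_image]
  exact image_stdCube (d := d) ▸ isCompact_univ_pi fun _ => isCompact_Icc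

theorem convex_stdCube : Convex ℝ (stdCube d) := fun _ hx _ hy _ _ ha hb hab i =>
  convex_Icc 0 1 (hx i) (hy i) ha hb hab

theorem extremePoints_stdCube : (stdCube d).extremePoints ℝ = Set.range cubePoint := by
  have h := image_extremePoints (𝕜 := ℝ) (EuclideanSpace.equiv (Fin d) ℝ) (stdCube d)
  rw [image_stdCube, extremePoints_pi] at h
  simp only [Set.extremePoints_Icc zero_le_one] at h
  ext v
  rw [← (EuclideanSpace.equiv (Fin d) ℝ).injective.mem_set_image, h, Set.mem_univ_pi]
  constructor
  · intro hv
    refine ⟨fun i => decide (v i = 1), ?_⟩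
    ext i
    have hi : v i = 0 ∨ v i = 1 := hv i
    rw [cubePoint_apply]
    rcases hi with hi | hi <;> simp [hi]
  · rintro ⟨x, rfl⟩ i
    change cubePoint x i ∈ _
    rw [cubePoint_apply]
    cases x i <;> simp

theorem isPolytope_stdCube : IsPolytope (stdCube d) := by
  have hfin : ((stdCube d).extremePoints ℝ).Finite :=
    extremePoints_stdCube (d := d) ▸ Set.finite_range _
  refine ⟨_, hfin, ?_⟩
  rw [← (hfin.isClosed_convexHull ℝ).closure_eq]
  exact (closure_convexHull_extremePoints isCompact_stdCube convex_stdCube).symm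

/-- The functional that exposes the face is the sum of the coordinates in `J`, with sign `+` at the
coordinates equal to `1` and `-` at those equal to `0`. -/
theorem isExposed_stdCube_fixed_coordinates (J : Finset (Fin d)) (x : Fin d → Bool) :
    IsExposed ℝ (stdCube d) {y ∈ stdCube d | ∀ j ∈ J, y j = cubePoint x j} := by
  intro _
  let f : StrongDual ℝ (EuclideanSpace ℝ (Fin d)) :=
    ∑ j ∈ J, (if x j then (1 : ℝ) else -1) • EuclideanSpace.proj j
  have hf : ∀ y, f y = ∑ j ∈ J, (if x j then (1 : ℝ) else -1) * y j := fun y => by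
    simp only [f, sum_apply, smul_apply, smul_eq_mul, PiLp.proj_apply]
  have hle : ∀ y ∈ stdCube d, ∀ j ∈ J, (if x j then (1 : ℝ) else -1) * y j ≤
      (if x j then (1 : ℝ) else -1) * cubePoint x j := fun y hy j _ => by
    have := hy j
    rw [cubePoint_apply]
    split_ifs <;> linarith
  refine ⟨f, Set.Subset.antisymm ?_ ?_⟩
  · rintro y ⟨hy, hyJ⟩
    refine ⟨hy, fun z hz => ?_⟩
    rw [hf, hf]
    exact Finset.sum_le_sum fun j hj => hyJ j hj ▸ hle z hz j hj
  · rintro y ⟨hy, hmax⟩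
    refine ⟨hy, fun j hj => ?_⟩
    have hge := hmax _ (cubePoint_mem_stdCube x)
    rw [hf, hf] at hge
    have heq := (Finset.sum_eq_sum_iff_of_le (hle y hy)).1
      (le_antisymm (Finset.sum_le_sum (hle y hy)) hge) j hj
    split_ifs at heq <;> linarith

theorem isExposed_cubePoint (x : Fin d → Bool) : IsExposed ℝ (stdCube d) {cubePoint x} :=
  isPolytope_stdCube.mem_extremePoints_iff.1 (extremePoints_stdCube (d := d) ▸ ⟨x, rfl⟩)

/-- The vertices of `[0,1]^d`, as vertices of its graph, indexed by the vertices of the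
combinatorial cube. -/
noncomputable def cubeVertexEquiv :
    (Fin d → Bool) ≃ {v : EuclideanSpace ℝ (Fin d) // IsExposed ℝ (stdCube d) {v}} :=
  Equiv.ofBijective (fun x => ⟨cubePoint x, isExposed_cubePoint x⟩)
    ⟨fun _ _ h => cubePoint_injective (congrArg Subtype.val h), fun v => by
      have hv := isPolytope_stdCube.mem_extremePoints_iff.2 v.2
      rw [extremePoints_stdCube] at hv
      exact hv.imp fun _ h => Subtype.ext h⟩

theorem polytopeGraph_stdCube_adj {u v : Fin d → Bool} (h : (cubeGraph d).Adj u v) :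
    (polytopeGraph (stdCube d)).Adj (cubeVertexEquiv u) (cubeVertexEquiv v) := by
  obtain ⟨i, rfl⟩ := h
  refine isPolytope_stdCube.polytopeGraph_adj_iff.2
    ⟨fun h => flipAt_ne u i (cubeVertexEquiv.injective h).symm,
      ⟨_, isExposed_stdCube_fixed_coordinates (Finset.univ.erase i) u⟩,
      cubeVertexEquiv.surjective.forall.2 fun y => ?_⟩
  rw [cubeVertexEquiv.apply_eq_iff_eq, cubeVertexEquiv.apply_eq_iff_eq]
  rw [eq_or_eq_flipAt_iff]
  change (_ ∧ ∀ j ∈ _, cubePoint y j = cubePoint u j) ↔ _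
  simp only [cubePoint_apply_eq_iff, Finset.mem_erase, Finset.mem_univ, and_true]
  exact and_iff_right (cubePoint_mem_stdCube y)

theorem IsCube.exists_equiv {n : ℕ} {P : Set (EuclideanSpace ℝ (Fin n))} (hP : IsCube d P) :
    ∃ φ : (Fin d → Bool) ≃ {v : EuclideanSpace ℝ (Fin n) // IsExposed ℝ P {v}},
      ∀ u v, (cubeGraph d).Adj u v → (polytopeGraph P).Adj (φ u) (φ v) := by
  obtain ⟨hP, ⟨e⟩⟩ := hP
  obtain ⟨ψ⟩ := isPolytope_stdCube.nonempty_polytopeGraph_iso hP e.symm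
  exact ⟨cubeVertexEquiv.trans ψ.toEquiv, fun u v h =>
    ψ.map_adj_iff.2 (polytopeGraph_stdCube_adj h)⟩

end StandardCube

section StrongLinkedness

variable {V W ι : Type*} {G : SimpleGraph V} {H : SimpleGraph W} {d k : ℕ}

theorem exists_path_of_reachable {c : V → ι} {A : Set V} {u v : V}
    (h : (monochromaticOn G c A).Reachable u v) :
    ∃ p : G.Path u v, ∀ w ∈ p.1.support, c w = c u := by
  classical
  obtain ⟨q, hq⟩ := h.exists_isPath
  refine ⟨⟨q.mapLe (monochromaticOn_le_graph c A), hq.mapLe _⟩, fun w hw => ?_⟩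
  rw [SimpleGraph.Walk.support_mapLe_eq_support] at hw
  exact (color_eq_of_reachable ⟨q.takeUntil w hw⟩).symm

/-- The labelling that encodes `k` pairs `{s i, t i}`: the two vertices of the `i`-th pair get the
label `i`, and all other vertices get the label `k`. -/
noncomputable def pairIndex (s t : Fin k → V) : V → ℕ :=
  Function.extend (Sum.elim s t) (Sum.elim Fin.val Fin.val) fun _ => k

section PairIndex

variable {s t : Fin k → V}

theorem pairIndex_left (hst : Function.Injective (Sum.elim s t)) (i : Fin k) :
    pairIndex s t (s i) = i :=
  hst.extend_apply _ _ (Sum.inl i)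

theorem pairIndex_right (hst : Function.Injective (Sum.elim s t)) (i : Fin k) :
    pairIndex s t (t i) = i :=
  hst.extend_apply _ _ (Sum.inr i)

theorem pairIndex_of_forall_ne {v : V} (hv : ∀ j, v ≠ s j ∧ v ≠ t j) : pairIndex s t v = k :=
  Function.extend_apply' _ _ _ (by rintro ⟨j | j, rfl⟩; exacts [(hv j).1 rfl, (hv j).2 rfl])

theorem pairIndex_eq_iff (hst : Function.Injective (Sum.elim s t)) {v : V} {i : Fin k} :
    pairIndex s t v = i ↔ v = s i ∨ v = t i := by
  constructor
  · intro h
    by_cases hv : ∀ j, v ≠ s j ∧ v ≠ t j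
    · exact absurd ((pairIndex_of_forall_ne hv).symm.trans h) i.2.ne'
    · push Not at hv
      obtain ⟨j, hj⟩ := hv
      obtain rfl | hne := eq_or_ne v (s j)
      · rw [pairIndex_left hst, Fin.val_inj] at h
        exact Or.inl (h ▸ rfl)
      · obtain rfl := hj hne
        rw [pairIndex_right hst, Fin.val_inj] at h
        exact Or.inr (h ▸ rfl)
  · rintro (rfl | rfl)
    exacts [pairIndex_left hst i, pairIndex_right hst i]

theorem pairLabelled_pairIndex {X : Finset V} (hst : Function.Injective (Sum.elim s t))
    (hs : ∀ i, s i ∈ X) (ht : ∀ i, t i ∈ X) (hX : X.card ≤ 2 * k + 1) :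
    PairLabelled X (pairIndex s t) := by
  classical
  intro x hx y hy z _ hxy hxz
  by_cases h : ∃ i, x = s i ∨ x = t i
  · obtain ⟨i, hi⟩ := h
    have hxi := (pairIndex_eq_iff hst).2 hi
    have hy' := (pairIndex_eq_iff hst).1 (hxy.symm.trans hxi)
    have hz' := (pairIndex_eq_iff hst).1 (hxz.symm.trans hxi)
    grind
  · have hrest : (X \ Finset.univ.image (Sum.elim s t)).card ≤ 1 := by
      rw [Finset.card_sdiff_of_subset (by simp [Finset.image_subset_iff, hs, ht]),
        Finset.card_image_of_injective _ hst, Finset.card_univ, Fintype.card_sum, Fintype.card_fin]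
      omega
    have hout : ∀ w ∈ X, pairIndex s t x = pairIndex s t w →
        w ∈ X \ Finset.univ.image (Sum.elim s t) := fun w hw hxw => by
      refine Finset.mem_sdiff.2 ⟨hw, fun hmem => h ?_⟩
      obtain ⟨i | i, -, rfl⟩ := Finset.mem_image.1 hmem
      · exact ⟨i, (pairIndex_eq_iff hst).1 (hxw.trans (pairIndex_left hst i))⟩
      · exact ⟨i, (pairIndex_eq_iff hst).1 (hxw.trans (pairIndex_right hst i))⟩
    exact Or.inl (Finset.card_le_one.1 hrest x (hout x hx rfl) y (hout y hy hxy))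

end PairIndex

theorem isStronglyLinked_of_linkable (hV : ((d + 1 : ℕ) : ℕ∞) ≤ ENat.card V)
    (h : ∀ (X : Finset V) (l : V → ℕ), X.card = d + 1 → PairLabelled X l →
      Linkable G Set.univ X l) : IsStronglyLinked d G := by
  refine ⟨hV, fun X hX s t hs ht hst => ?_⟩
  obtain ⟨c, hc, hreach⟩ := h X (pairIndex s t) hX
    (pairLabelled_pairIndex hst hs ht (by omega))
  have hpath : ∀ i, ∃ p : G.Path (s i) (t i), ∀ w ∈ p.1.support, c w = i := fun i => by
    obtain ⟨p, hp⟩ := exists_path_of_reachable (hreach (s i) (hs i) (t i) (ht i)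
      ((pairIndex_left hst i).trans (pairIndex_right hst i).symm))
    rw [hc _ (hs i), pairIndex_left hst] at hp
    exact ⟨p, hp⟩
  choose L hL using hpath
  refine ⟨L, fun i j hij v hvi hvj => hij (Fin.ext ((hL i v hvi).symm.trans (hL j v hvj))),
    fun x hx hxout i hxi => i.2.ne ?_⟩
  rw [← hL i x hxi, hc x hx, pairIndex_of_forall_ne hxout]

theorem CubeLinked.isStronglyLinked (hd : CubeLinked d) : IsStronglyLinked d (cubeGraph d) := by
  refine isStronglyLinked_of_linkable ?_ fun X l hX => hd X l hX.le
  rw [ENat.card_eq_coe_fintype_card, Fintype.card_fun, Fintype.card_bool, Fintype.card_fin]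
  exact_mod_cast Nat.lt_two_pow_self

theorem IsStronglyLinked.map (hG : IsStronglyLinked d G) (φ : V ≃ W)
    (hφ : ∀ u v, G.Adj u v → H.Adj (φ u) (φ v)) : IsStronglyLinked d H := by
  refine ⟨ENat.card_congr φ ▸ hG.1, fun X hX s t hs ht hst => ?_⟩
  obtain ⟨X, rfl⟩ : ∃ X' : Finset V, X'.map φ.toEmbedding = X := φ.finsetCongr.surjective X
  obtain ⟨s, rfl⟩ : ∃ s', φ ∘ s' = s := ⟨φ.symm ∘ s, by simp [← Function.comp_assoc]⟩
  obtain ⟨t, rfl⟩ : ∃ t', φ ∘ t' = t := ⟨φ.symm ∘ t, by simp [← Function.comp_assoc]⟩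
  rw [← Sum.comp_elim] at hst
  simp only [Finset.mem_map_equiv, Function.comp_apply, Equiv.symm_apply_apply] at hs ht
  obtain ⟨L, hdisj, havoid⟩ := hG.2 X (by simpa using hX) s t hs ht hst.of_comp
  let F : G →g H := ⟨φ, hφ _ _⟩
  have hsupp : ∀ i w, w ∈ ((L i).map F φ.injective).1.support ↔ φ.symm w ∈ (L i).1.support :=
    fun i => φ.surjective.forall.2 fun v => by simp [F, SimpleGraph.Walk.support_map]
  refine ⟨fun i => (L i).map F φ.injective, fun i j hij w => ?_, fun x hx hxout i => ?_⟩
  · rw [hsupp, hsupp]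
    exact hdisj i j hij _
  · rw [hsupp]
    refine havoid _ (by simpa using hx) (fun j => ?_) i
    simpa [φ.symm_apply_eq] using hxout j

end StrongLinkedness

theorem mainTheorem5 (d : ℕ) (hd : d ≠ 3) (n : ℕ) (P : Set (EuclideanSpace ℝ (Fin n)))
    (hP : IsCube d P) : IsStronglyLinked d (polytopeGraph P) := by
  obtain ⟨φ, hφ⟩ := hP.exists_equiv
  exact (cubeLinked hd).isStronglyLinked.map φ hφ
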